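/- All manifolds are smooth ($C^\infty$), Hausdorff, second countable and without boundary; vector spaces are real and finite-dimensional. **Definitions.** Let $V$ be a vector space and let $D_m(V)\subset\bigwedge^m V$ be the cone of decomposable $m$-vectors. An $m$-density on $V$ is a continuous function $\delta:D_m(V)\to\mathbb R$ with $\delta(t\zeta)=|t|\,\delta(\zeta)$ for all $t\in\mathbb R$. An $m$-density on a manifold $X$ is a family of $m$-densities $\delta_x$ on $T_xX$ depending continuously on $x$, i.e. $(x;\xi_1,\dots,\xi_m)\mapsto\delta_x(\xi_1\wedge\dots\wedge\xi_m)$ is continuous on $TX\oplus\dots\oplus TX$. Let $\mathrm{AGr}^m(V)$ be the space of affine subspaces of $V$ of codimension $m$, with its usual topology. A signed Borel measure on $\mathrm{AGr}^m(V)$ is called normal if it is finite on compact sets and invariant under translations of $V$. An $m$-density $\delta$ on $V$ is called normal if there is a normal measure $\mu$ on $\mathrm{AGr}^m(V)$ with $$\delta(\xi_1\wedge\dots\wedge\xi_m)=\mu\bigl(\{H\in\mathrm{AGr}^m(V)\;:\;H\cap\Pi_\xi\neq\emptyset\}\bigr)\quad\text{for all }\xi_1,\dots,\xi_m\in V,$$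 where $\Pi_\xi=\{\sum_i t_i\xi_i : 0\le t_i\le 1\}$ is the parallelotope generated by the $\xi_i$. An $m$-density $\delta$ on a manifold $X$ is called normal if $\delta_x$ is a normal density on $T_xX$ for every $x\in X$. An $m$-density $\delta$ on $X$ is called locally decomposable if every point of $X$ has an open neighbourhood on which $\delta=|\omega|$ for a decomposable $m$-form $\omega=c\,\varphi_1\wedge\dots\wedge\varphi_m$ with a continuous function $c$ and continuous $1$-forms $\varphi_i$ on that neighbourhood. Let $p:X\to Y$ be a smooth locally trivial fiber bundle whose typical fiber is a compact manifold of dimension $k$, let $F_y=p^{-1}(y)$, and let $\delta$ be an $m$-density on $X$ with $m\ge k$. The push-forward $p_*\delta$ is defined by $$(p_*\delta)_y(\eta_1\wedge\dots\wedge\eta_{m-k})=\int_{F_y}\xi\lrcorner\,\delta,\qquad \eta_1,\dots,\eta_{m-k}\in T_yY,$$ where $\xi\lrcorner\,\delta$ is the $k$-density on $F_y$ given at $x\in F_y$ by $(\xi\lrcorner\,\delta)(f_1\wedge\dots\wedge f_k)=\delta_x(\xi_1\wedge\dots\wedge\xi_{m-k}\wedge f_1\wedge\dots\wedge f_k)$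 for $f_1,\dots,f_k\in T_xF_y$, with any $\xi_i\in T_xX$ such that $dp_x(\xi_i)=\eta_i$. **Proposition.** Let $p:X\to Y$ be a smooth locally trivial fiber bundle with compact fiber of dimension $k$, let $m\ge k$, and let $\delta$ be a locally decomposable $m$-density on $X$. Then the push-forward $p_*\delta$ is a normal $(m-k)$-density on $Y$. -/

import Mathlib

open scoped Manifold ContDiff Topology
open MeasureTheory Bundle

noncomputable section

namespace NormalDensity

/-! ### Densities and normal densities on a (finite-dimensional) real vector space -/

section VectorSpace

/-- The homogeneity of an `m`-density on `V`. A density is a function `δ` on the cone of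
decomposable `m`-vectors with `δ (t ζ) = |t| δ ζ`; here it is recorded as the function
`(ξ₁, …, ξₘ) ↦ δ (ξ₁ ∧ … ∧ ξₘ)` on `m`-tuples of vectors. The case `t = 1` below says that the value
depends only on the `m`-vector `ξ₁ ∧ … ∧ ξₘ`, and the general case is the homogeneity. -/
def IsHomogeneousDensity {V : Type*} [AddCommGroup V] [Module ℝ V] {m : ℕ}
    (δ : (Fin m → V) → ℝ) : Prop :=
  ∀ (t : ℝ) (ξ ξ' : Fin m → V),
    exteriorPower.ιMulti ℝ m ξ = t • exteriorPower.ιMulti ℝ m ξ' → δ ξ = |t| * δ ξ'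

/-- The affine Grassmannian `AGrᵐ(V)`: nonempty affine subspaces of `V` of codimension `m`. -/
def AGr (m : ℕ) (V : Type*) [AddCommGroup V] [Module ℝ V] [FiniteDimensional ℝ V] : Type _ :=
  {H : AffineSubspace ℝ V //
    (H : Set V).Nonempty ∧ Module.finrank ℝ H.direction + m = Module.finrank ℝ V}

variable {V : Type*} [AddCommGroup V] [Module ℝ V] [FiniteDimensional ℝ V] {m : ℕ}

/-- The solution set `{v | A v = b}` of a linear system of rank `m`. -/
def AGr.solutions [TopologicalSpace V]
    (z : {A : V →L[ℝ] (Fin m → ℝ) // Function.Surjective A} × (Fin m → ℝ)) : AGr m V :=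
  ⟨(AffineSubspace.mk' z.2 ⊥).comap z.1.1.toLinearMap.toAffineMap, by
    obtain ⟨⟨A, hA⟩, b⟩ := z
    obtain ⟨v, hv⟩ := hA b
    have hmem : v ∈ (AffineSubspace.mk' b (⊥ : Submodule ℝ (Fin m → ℝ))).comap
        A.toLinearMap.toAffineMap := by
      simp [AffineSubspace.mem_comap, hv]
    refine ⟨⟨v, hmem⟩, ?_⟩
    have hdir : ((AffineSubspace.mk' b (⊥ : Submodule ℝ (Fin m → ℝ))).comap
        A.toLinearMap.toAffineMap).direction = LinearMap.ker A.toLinearMap := by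
      ext w
      rw [← AffineSubspace.vadd_mem_iff_mem_direction w hmem]
      simp [AffineSubspace.mem_comap, hv]
    have hrange : LinearMap.range A.toLinearMap = ⊤ := LinearMap.range_eq_top.2 hA
    have h := LinearMap.finrank_range_add_finrank_ker A.toLinearMap
    rw [hrange, finrank_top, Module.finrank_fin_fun] at h
    show Module.finrank ℝ (AffineSubspace.direction _) + m = _
    rw [hdir]
    omega⟩

theorem AGr.mem_solutions [TopologicalSpace V]
    (z : {A : V →L[ℝ] (Fin m → ℝ) // Function.Surjective A} × (Fin m → ℝ)) (v : V) :
    v ∈ (AGr.solutions z).1 ↔ z.1.1 v = z.2 := by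
  simp [AGr.solutions, AffineSubspace.mem_comap, sub_eq_zero]

/-- The usual topology of `AGrᵐ(V)`: the quotient topology from the space of linear systems
`A v = b` of rank `m` (the quotient by the action of `GL(m, ℝ)`). -/
instance [TopologicalSpace V] : TopologicalSpace (AGr m V) :=
  TopologicalSpace.coinduced AGr.solutions inferInstance

instance [TopologicalSpace V] : MeasurableSpace (AGr m V) := borel _

instance [TopologicalSpace V] : BorelSpace (AGr m V) := ⟨rfl⟩

/-- The translate `v + H` of an affine subspace. -/
def AGr.translate (v : V) (H : AGr m V) : AGr m V :=
  ⟨H.1.map (AffineEquiv.constVAdd ℝ V v).toAffineMap, by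
    refine ⟨?_, ?_⟩
    · rw [AffineSubspace.coe_map]
      exact H.2.1.image _
    · have h : (H.1.map (AffineEquiv.constVAdd ℝ V v).toAffineMap).direction = H.1.direction := by
        rw [AffineSubspace.map_direction]
        exact Submodule.map_id _
      rw [h]
      exact H.2.2⟩

/-- The set `𝒥_{m,D}` of affine subspaces of codimension `m` that meet `D`. -/
def AGr.meeting (m : ℕ) (D : Set V) : Set (AGr m V) :=
  {H | ((H.1 : Set V) ∩ D).Nonempty}

/-- A (positive) normal measure: a Borel measure on `AGrᵐ(V)` that is finite on compact sets and
invariant under all translations of `V`. -/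
structure IsNormalMeasure [TopologicalSpace V] (μ : Measure (AGr m V)) : Prop where
  finite_on_compacts : ∀ K : Set (AGr m V), IsCompact K → μ K < ⊤
  translation_invariant : ∀ (v : V) (B : Set (AGr m V)), MeasurableSet B →
    μ (AGr.translate v ⁻¹' B) = μ B

/-- Membership in `𝔫ₘ(V)`: the density comes from a normal signed measure `μ` on `AGrᵐ(V)`, that is
`δ (ξ₁ ∧ … ∧ ξₘ) = μ (𝒥_{m,Π})` with `Π` the parallelotope generated by the `ξᵢ`.
A signed Borel measure that is finite on compact sets is a difference `μ = μ₁ - μ₂` of positive ones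
(evaluated on relatively compact sets such as `𝒥_{m,Π}`); its Jordan components are translation
invariant when `μ` is. -/
def IsNormal [TopologicalSpace V] (δ : (Fin m → V) → ℝ) : Prop :=
  ∃ μ₁ μ₂ : Measure (AGr m V), IsNormalMeasure μ₁ ∧ IsNormalMeasure μ₂ ∧
    ∀ ξ : Fin m → V, δ ξ =
      μ₁.real (AGr.meeting m (parallelepiped ξ)) - μ₂.real (AGr.meeting m (parallelepiped ξ))

end VectorSpace

/-! ### Densities on manifolds -/

section Manifold

/-- The model space of `d`-dimensional manifolds. -/
abbrev E (d : ℕ) : Type := EuclideanSpace ℝ (Fin d)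

instance (d : ℕ) (X : Type*) [TopologicalSpace X] [ChartedSpace (E d) X] (x : X) :
    FiniteDimensional ℝ (TangentSpace (𝓡 d) x) :=
  inferInstanceAs (FiniteDimensional ℝ (E d))

/-- A point of `X` with an `m`-tuple of tangent vectors at this point: the total space of the
Whitney sum `TX ⊕ … ⊕ TX` of `m` copies of the tangent bundle. -/
structure TangentTuple (d m : ℕ) (X : Type*) [TopologicalSpace X] [ChartedSpace (E d) X] where
  base : X
  vec : Fin m → TangentSpace (𝓡 d) base

/-- The topology of the Whitney sum, as a subspace of `X × TX × … × TX`. -/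
instance (d m : ℕ) (X : Type*) [TopologicalSpace X] [ChartedSpace (E d) X]
    [IsManifold (𝓡 d) ∞ X] : TopologicalSpace (TangentTuple d m X) :=
  TopologicalSpace.induced
    (fun w => (w.base, fun i => (⟨w.base, w.vec i⟩ : TangentBundle (𝓡 d) X)))
    (inferInstance : TopologicalSpace (X × (Fin m → TangentBundle (𝓡 d) X)))

/-- A family assigning to each `x` a function of `m` tangent vectors at `x`. -/
abbrev TupleFunction (d m : ℕ) (X : Type*) [TopologicalSpace X] [ChartedSpace (E d) X] : Type _ :=
  (x : X) → (Fin m → TangentSpace (𝓡 d) x) → ℝ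

variable {d m : ℕ} {X : Type*} [TopologicalSpace X] [ChartedSpace (E d) X]
  [IsManifold (𝓡 d) ∞ X]

/-- An `m`-density on `X`: an `m`-density `δ x` on each tangent space `TₓX`, depending continuously
on `x` (that is, the value is continuous jointly in the point and the tangent vectors). -/
structure IsDensity (δ : TupleFunction d m X) : Prop where
  homogeneous : ∀ x, IsHomogeneousDensity (δ x)
  continuous : Continuous fun w : TangentTuple d m X => δ w.base w.vec

/-- A normal `m`-density on `X`: an `m`-density whose value at each `x` lies in `𝔫ₘ(TₓX)`. -/
structure IsNormalDensity (δ : TupleFunction d m X) : Prop extends IsDensity δ where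
  normal : ∀ x, IsNormal (δ x)

/-- A (continuous) field of covectors on `U`, i.e. a `1`-form on `U`: a function on the restriction of
the tangent bundle to `U` that is linear on each fiber and continuous. -/
def IsOneFormOn (φ : (x : X) → TangentSpace (𝓡 d) x →ₗ[ℝ] ℝ) (U : Set X) : Prop :=
  ContinuousOn (fun v : TangentBundle (𝓡 d) X => φ v.proj v.2) (TotalSpace.proj ⁻¹' U)

/-- Locally, `δ` is the absolute value of a decomposable `m`-form
`ω = c • φ₁ ∧ … ∧ φₘ`, `(φ₁ ∧ … ∧ φₘ) (ξ₁, …, ξₘ) = det (φᵢ (ξⱼ))`, with `1`-forms `φᵢ` and a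
function `c`. (For `m ≥ 1` the factor `c` can be absorbed into `φ₁`; for `m = 0` decomposable forms
are arbitrary functions.) -/
def IsLocallyDecomposable (δ : TupleFunction d m X) : Prop :=
  ∀ x₀ : X, ∃ U : Set X, IsOpen U ∧ x₀ ∈ U ∧
    ∃ (c : X → ℝ) (φ : Fin m → (x : X) → TangentSpace (𝓡 d) x →ₗ[ℝ] ℝ),
      ContinuousOn c U ∧ (∀ i, IsOneFormOn (φ i) U) ∧
      ∀ x ∈ U, ∀ ξ : Fin m → TangentSpace (𝓡 d) x,
        δ x ξ = |c x * (Matrix.of fun i j => φ i x (ξ j)).det|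

end Manifold

/-! ### Integration of top-order densities over a compact manifold -/

section Integration

/-- A smooth partition of unity subordinate to the preferred charts of `F`. -/
def chartPartition (k : ℕ) (F : Type*) [TopologicalSpace F] [ChartedSpace (E k) F]
    [IsManifold (𝓡 k) ∞ F] [T2Space F] [CompactSpace F] :
    SmoothPartitionOfUnity F (𝓡 k) F Set.univ :=
  (SmoothPartitionOfUnity.exists_isSubordinate_chartAt_source (𝓡 k) F).choose

/-- The integral over a compact `k`-manifold `F` of a `k`-density `σ`: with a smooth partition of
unity `ρᵢ` subordinate to charts `κᵢ`, it is the sum over `i` of the Lebesgue integrals of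
`ρᵢ · σ (∂₁ ∧ … ∧ ∂ₖ)` in the coordinates `κᵢ`. (It does not depend on the partition or charts.) -/
def densityIntegral {k : ℕ} {F : Type*} [TopologicalSpace F] [ChartedSpace (E k) F]
    [IsManifold (𝓡 k) ∞ F] [T2Space F] [CompactSpace F] (σ : TupleFunction k k F) : ℝ :=
  ∑ᶠ i : F, ∫ u in (chartAt (E k) i).target,
    chartPartition k F i ((chartAt (E k) i).symm u) *
      σ ((chartAt (E k) i).symm u)
        (fun a => mfderiv (𝓡 k) (𝓡 k) (chartAt (E k) i).symm u
          (EuclideanSpace.single a (1 : ℝ) : E k))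

end Integration

/-! ### Fiber bundles and the push-forward of densities -/

section Pushforward

/-- A smooth locally trivial fiber bundle `p : X → Y` with typical fiber `F`: every point of `Y` has
an open neighbourhood over which there is a fiber-preserving diffeomorphism
`p⁻¹(baseSet) ≃ baseSet × F`. -/
def IsSmoothFiberBundle (d n k : ℕ) {X Y : Type*} (F : Type*)
    [TopologicalSpace X] [ChartedSpace (E d) X] [TopologicalSpace Y] [ChartedSpace (E n) Y]
    [TopologicalSpace F] [ChartedSpace (E k) F] (p : X → Y) : Prop :=
  ∀ y : Y, ∃ e : Trivialization F p, y ∈ e.baseSet ∧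
    ContMDiffOn (𝓡 d) ((𝓡 n).prod (𝓡 k)) ∞ e e.source ∧
    ContMDiffOn ((𝓡 n).prod (𝓡 k)) (𝓡 d) ∞ e.toOpenPartialHomeomorph.symm e.target

variable {d n k j : ℕ} {X Y F : Type*}
  [TopologicalSpace X] [ChartedSpace (E d) X]
  [TopologicalSpace Y] [ChartedSpace (E n) Y]
  [TopologicalSpace F] [ChartedSpace (E k) F] {p : X → Y}

/-- The diffeomorphism of `F` onto the fiber `F_y = p⁻¹(y)` given by a local trivialization at `y`. -/
def fiberParam (hp : IsSmoothFiberBundle d n k F p) (y : Y) (z : F) : X :=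
  (hp y).choose.toOpenPartialHomeomorph.symm (y, z)

/-- An arbitrarily chosen tangent vector `ξ` at `x` with `dpₓ ξ = η`. -/
def tangentLift (d n : ℕ) {X Y : Type*} [TopologicalSpace X] [ChartedSpace (E d) X]
    [TopologicalSpace Y] [ChartedSpace (E n) Y]
    (p : X → Y) (x : X) (η : TangentBundle (𝓡 n) Y) : TangentSpace (𝓡 d) x :=
  Classical.epsilon fun ξ => tangentMap (𝓡 d) (𝓡 n) p ⟨x, ξ⟩ = η

/-- The density `ξ ⌟ δ` on the fiber `F_y`, `(f₁, …, fₖ) ↦ δ (ξ₁ ∧ … ∧ ξⱼ ∧ f₁ ∧ … ∧ fₖ)` with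
`dp (ξᵢ) = ηᵢ`, transported to `F` by `fiberParam`. -/
def fiberDensity (hp : IsSmoothFiberBundle d n k F p) (δ : TupleFunction d (j + k) X)
    (y : Y) (η : Fin j → TangentSpace (𝓡 n) y) : TupleFunction k k F :=
  fun z f => δ (fiberParam hp y z) (Fin.append
    (fun i => tangentLift d n p (fiberParam hp y z) ⟨y, η i⟩)
    (fun a => mfderiv (𝓡 k) (𝓡 d) (fiberParam hp y) z (f a)))

/-- The push-forward `p_* δ` of an `m`-density, `m = j + k`, along a fiber bundle with compact
`k`-dimensional fiber: `p_* δ (η₁ ∧ … ∧ ηⱼ) = ∫_{F_y} ξ ⌟ δ`, where `dp (ξᵢ) = ηᵢ`. -/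
def pushforward [IsManifold (𝓡 k) ∞ F] [T2Space F] [CompactSpace F]
    (hp : IsSmoothFiberBundle d n k F p) (δ : TupleFunction d (j + k) X) : TupleFunction n j Y :=
  fun y η => densityIntegral (fiberDensity hp δ y η)

end Pushforward

end NormalDensity

end

namespace NormalDensity

/-! ### Splitting off columns of a determinant -/

section Householder

open Matrix

variable {m : ℕ}

/-- The normal vector of the reflection that maps `b` to a multiple of the last basis vector. -/
noncomputable def householderVec (b : Fin (m + 1) → ℝ) : Fin (m + 1) → ℝ :=
  b - Pi.single (Fin.last m) √(b ⬝ᵥ b)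

/-- The reflection that maps `b` to `|b|` times the last basis vector. -/
noncomputable def householder (b : Fin (m + 1) → ℝ) : Matrix (Fin (m + 1)) (Fin (m + 1)) ℝ :=
  1 - (2 / (householderVec b ⬝ᵥ householderVec b)) •
    vecMulVec (householderVec b) (householderVec b)

theorem householder_mulVec (b v : Fin (m + 1) → ℝ) :
    householder b *ᵥ v = v - (2 / (householderVec b ⬝ᵥ householderVec b) *
      (householderVec b ⬝ᵥ v)) • householderVec b := by
  rw [householder, sub_mulVec, one_mulVec, smul_mulVec, vecMulVec_mulVec]
  ext i
  simp
  ring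

theorem abs_det_householder (b : Fin (m + 1) → ℝ) : |(householder b).det| = 1 := by
  have h : householder b * householder b = 1 := by
    have hv : ∀ v, householder b *ᵥ (householder b *ᵥ v) = v := by
      intro v
      rw [householder_mulVec b (householder b *ᵥ v), householder_mulVec]
      set u := householderVec b
      by_cases hu : u ⬝ᵥ u = 0
      · simp [hu]
      · ext i
        simp only [dotProduct_sub, dotProduct_smul, smul_eq_mul, Pi.sub_apply, Pi.smul_apply]
        field_simp
        ring
    refine Matrix.toLin'.injective (LinearMap.ext fun v => ?_)
    simpa [Matrix.toLin'_apply] using hv v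
  have h2 : (householder b).det * (householder b).det = 1 := by
    rw [← det_mul, h, det_one]
  rcases mul_self_eq_one_iff.1 h2 with h3 | h3 <;> simp [h3]

theorem householder_mulVec_self (b : Fin (m + 1) → ℝ) :
    householder b *ᵥ b = Pi.single (Fin.last m) √(b ⬝ᵥ b) := by
  have hb : 0 ≤ b ⬝ᵥ b := by
    simpa using dotProduct_star_self_nonneg b
  have hs : √(b ⬝ᵥ b) * √(b ⬝ᵥ b) = b ⬝ᵥ b := Real.mul_self_sqrt hb
  have h1 : householderVec b ⬝ᵥ b = b ⬝ᵥ b - √(b ⬝ᵥ b) * b (Fin.last m) := by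
    simp [householderVec, sub_dotProduct]
  have h2 : householderVec b ⬝ᵥ householderVec b =
      2 * (b ⬝ᵥ b - √(b ⬝ᵥ b) * b (Fin.last m)) := by
    rw [← h1]
    nth_rewrite 2 [householderVec]
    rw [dotProduct_sub, two_mul, sub_eq_add_neg, add_right_inj, h1]
    simp [householderVec, sub_mul, hs]
    ring
  rw [householder_mulVec, h2, h1]
  by_cases hu : b ⬝ᵥ b - √(b ⬝ᵥ b) * b (Fin.last m) = 0
  · have hz : householderVec b = 0 := by
      rw [← dotProduct_self_eq_zero, h2, hu, mul_zero]
    rw [hz, smul_zero, sub_zero]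
    exact sub_eq_zero.1 hz
  · have : 2 / (2 * (b ⬝ᵥ b - √(b ⬝ᵥ b) * b (Fin.last m))) *
        (b ⬝ᵥ b - √(b ⬝ᵥ b) * b (Fin.last m)) = 1 := by
      field_simp
    rw [this, one_smul, householderVec]
    abel

theorem abs_householder_le (b : Fin (m + 1) → ℝ) (i a : Fin (m + 1)) : |householder b i a| ≤ 3 := by
  set u := householderVec b with hu
  have hsq : ∀ i, u i ^ 2 ≤ u ⬝ᵥ u := fun i => by
    rw [dotProduct, sq]
    exact Finset.single_le_sum (f := fun i => u i * u i) (fun i _ => mul_self_nonneg _)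
      (Finset.mem_univ i)
  have h0 : 0 ≤ u ⬝ᵥ u := (sq_nonneg _).trans (hsq i)
  have h1 : |2 / (u ⬝ᵥ u) * (u i * u a)| ≤ 2 := by
    rcases h0.eq_or_lt with h | h
    · rw [← h]; norm_num
    · rw [abs_mul, abs_of_pos (by positivity), div_mul_eq_mul_div, div_le_iff₀ h]
      have : |u i * u a| ≤ u ⬝ᵥ u := by
        rw [abs_le]
        constructor <;> nlinarith [hsq i, hsq a, sq_nonneg (u i + u a), sq_nonneg (u i - u a)]
      linarith
  have h2 : |(1 : Matrix (Fin (m + 1)) (Fin (m + 1)) ℝ) i a| ≤ 1 := by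
    rw [Matrix.one_apply]; split_ifs <;> simp
  rw [householder, Matrix.sub_apply, Matrix.smul_apply, vecMulVec_apply, smul_eq_mul]
  exact (abs_sub _ _).trans (by linarith)

theorem measurable_householder (i a : Fin (m + 1)) :
    Measurable fun b : Fin (m + 1) → ℝ => householder b i a := by
  have h1 : Measurable fun b : Fin (m + 1) → ℝ => b ⬝ᵥ b := by
    unfold dotProduct
    fun_prop
  have h2 : ∀ i, Measurable fun b : Fin (m + 1) → ℝ => householderVec b i := fun i => by
    unfold householderVec
    simp only [Pi.sub_apply, Pi.single_apply]
    split_ifs <;> fun_prop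
  have h3 : Measurable fun b : Fin (m + 1) → ℝ => householderVec b ⬝ᵥ householderVec b := by
    unfold dotProduct
    fun_prop
  have h4 : (fun b : Fin (m + 1) → ℝ => householder b i a) = fun b =>
      (1 : Matrix (Fin (m + 1)) (Fin (m + 1)) ℝ) i a -
        2 / (householderVec b ⬝ᵥ householderVec b) * (householderVec b i * householderVec b a) :=
    rfl
  rw [h4]
  exact measurable_const.sub ((measurable_const.div h3).mul ((h2 i).mul (h2 a)))

theorem abs_det_snoc (v : Fin m → Fin (m + 1) → ℝ) (b : Fin (m + 1) → ℝ) :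
    |(Matrix.of fun i a => (Fin.snoc v b : Fin (m + 1) → Fin (m + 1) → ℝ) a i).det| =
      √(b ⬝ᵥ b) * |(Matrix.of fun i a => (householder b *ᵥ v a) (Fin.castSucc i)).det| := by
  set N := Matrix.of fun i a => (Fin.snoc v b : Fin (m + 1) → Fin (m + 1) → ℝ) a i with hN
  have h1 : |N.det| = |(householder b * N).det| := by
    rw [det_mul, abs_mul, abs_det_householder, one_mul]
  have hcol : ∀ i a, (householder b * N) i a =
      (householder b *ᵥ (Fin.snoc v b : Fin (m + 1) → Fin (m + 1) → ℝ) a) i := fun i a => rfl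
  rw [h1, det_succ_column _ (Fin.last m), Finset.sum_eq_single (Fin.last m)]
  · rw [hcol, Fin.snoc_last, householder_mulVec_self, abs_mul, abs_mul, abs_pow, abs_neg, abs_one,
      one_pow, one_mul, Pi.single_eq_same, abs_of_nonneg (Real.sqrt_nonneg _)]
    congr 3
    ext i a
    simp [hcol]
  · intro i _ hi
    rw [hcol, Fin.snoc_last, householder_mulVec_self, Pi.single_eq_of_ne hi]
    simp
  · simp

/-- The `j`-form `(v₁, …, vⱼ) ↦ det (v₁, …, vⱼ, B₁, …, Bₖ)` is, up to sign, a multiple of the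
determinant of a linear map to `ℝʲ`, depending on `B` in a measurable and bounded way. -/
theorem exists_reduction (j k : ℕ) :
    ∃ (G : (Fin k → Fin (j + k) → ℝ) → Matrix (Fin j) (Fin (j + k)) ℝ)
      (w : (Fin k → Fin (j + k) → ℝ) → ℝ),
      (∀ i a, Measurable fun B => G B i a) ∧ Measurable w ∧
      (∃ C, ∀ B i a, |G B i a| ≤ C) ∧
      (∀ R, ∃ C, ∀ B, (∀ a i, |B a i| ≤ R) → |w B| ≤ C) ∧
      (∀ B a, G B *ᵥ B a = 0) ∧
      ∀ (v : Fin j → Fin (j + k) → ℝ) B,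
        |(Matrix.of fun i a => (Fin.append v B : Fin (j + k) → Fin (j + k) → ℝ) a i).det| =
        |w B| * |(Matrix.of fun i a => (G B *ᵥ v a) i).det| := by
  induction k with
  | zero =>
    refine ⟨fun _ => 1, fun _ => 1, fun _ _ => measurable_const, measurable_const,
      ⟨1, fun B i a => ?_⟩, fun R => ⟨1, fun B _ => by simp⟩, fun B a => a.elim0, fun v B => ?_⟩
    · simp only [Matrix.one_apply]; split_ifs <;> simp
    · have : Fin.append v B = v := by
        rw [Subsingleton.elim B Fin.elim0, Fin.append_elim0]; rfl
      simp only [this, abs_one, one_mul]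
      congr 3
      ext i a
      exact (congrFun (one_mulVec (v a)) i).symm
  | succ k ih =>
    obtain ⟨G, w, hG, hw, ⟨C, hC⟩, hR, hGB, hdet⟩ := ih
    let H : (Fin (j + k + 1) → ℝ) → Matrix (Fin (j + k)) (Fin (j + k + 1)) ℝ :=
      fun b => Matrix.of fun i a => householder b (Fin.castSucc i) a
    have hHm : ∀ i a, Measurable fun b => H b i a := fun i a => measurable_householder _ _
    have hHb : ∀ b i a, |H b i a| ≤ 3 := fun b i a => abs_householder_le _ _ _
    have hHv : ∀ b v i, (H b *ᵥ v) i = (householder b *ᵥ v) (Fin.castSucc i) := fun b v i => rfl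
    let B' : (Fin (k + 1) → Fin (j + k + 1) → ℝ) → Fin k → Fin (j + k) → ℝ :=
      fun B a => H (B (Fin.last k)) *ᵥ B (Fin.castSucc a)
    have hB'm : Measurable B' := by
      refine measurable_pi_lambda _ fun a => measurable_pi_lambda _ fun i => ?_
      change Measurable fun B : Fin (k + 1) → Fin (j + k + 1) → ℝ =>
        ∑ l, H (B (Fin.last k)) i l * B (Fin.castSucc a) l
      refine Finset.measurable_sum _ fun l _ => ?_
      exact ((hHm i l).comp (measurable_pi_apply _)).mul
        ((measurable_pi_apply l).comp (measurable_pi_apply _))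
    refine ⟨fun B => G (B' B) * H (B (Fin.last k)),
      fun B => √(B (Fin.last k) ⬝ᵥ B (Fin.last k)) * w (B' B), fun i a => ?_, ?_, ?_, ?_, ?_, ?_⟩
    · change Measurable fun B : Fin (k + 1) → Fin (j + k + 1) → ℝ =>
        ∑ l, G (B' B) i l * H (B (Fin.last k)) l a
      refine Finset.measurable_sum _ fun l _ => ?_
      exact ((hG i l).comp hB'm).mul ((hHm l a).comp (measurable_pi_apply _))
    · refine Measurable.mul (Measurable.sqrt ?_) (hw.comp hB'm)
      unfold dotProduct
      fun_prop
    · refine ⟨(j + k : ℕ) * (C * 3), fun B i a => ?_⟩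
      change |∑ l, G (B' B) i l * H (B (Fin.last k)) l a| ≤ _
      refine (Finset.abs_sum_le_sum_abs _ _).trans ?_
      refine (Finset.sum_le_card_nsmul _ _ (C * 3) fun l _ => ?_).trans (by simp)
      rw [abs_mul]
      exact mul_le_mul (hC _ _ _) (hHb _ _ _) (abs_nonneg _) ((abs_nonneg _).trans (hC (B' B) i l))
    · intro R
      obtain ⟨D, hD⟩ := hR ((j + k + 1 : ℕ) * (3 * R))
      refine ⟨√((j + k + 1 : ℕ) * (R * R)) * D, fun B hB => ?_⟩
      rw [abs_mul, abs_of_nonneg (Real.sqrt_nonneg _)]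
      refine mul_le_mul (Real.sqrt_le_sqrt ?_) (hD _ fun a i => ?_) (abs_nonneg _)
        (Real.sqrt_nonneg _)
      · refine (Finset.sum_le_card_nsmul _ _ (R * R) fun l _ => ?_).trans
          (by simp [add_assoc])
        rw [← abs_mul_abs_self]
        exact mul_self_le_mul_self (abs_nonneg _) (hB _ _)
      · change |∑ l, H (B (Fin.last k)) i l * B (Fin.castSucc a) l| ≤ _
        refine (Finset.abs_sum_le_sum_abs _ _).trans ?_
        refine (Finset.sum_le_card_nsmul _ _ (3 * R) fun l _ => ?_).trans (by simp)
        rw [abs_mul]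
        exact mul_le_mul (hHb _ _ _) (hB _ _) (abs_nonneg _) (by norm_num)
    · intro B a
      rw [← Matrix.mulVec_mulVec]
      refine Fin.lastCases ?_ (fun a => hGB (B' B) a) a
      have : H (B (Fin.last k)) *ᵥ B (Fin.last k) = 0 := by
        ext i
        rw [hHv, householder_mulVec_self]
        simp
      rw [this, mulVec_zero]
    · intro v B
      have hB : B = Fin.snoc (Fin.init B) (B (Fin.last k)) := (Fin.snoc_init_self B).symm
      have h1 := abs_det_snoc (Fin.append v (Fin.init B)) (B (Fin.last k))
      have h2 : (fun a => H (B (Fin.last k)) *ᵥ Fin.append v (Fin.init B) a) =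
          Fin.append (fun a => H (B (Fin.last k)) *ᵥ v a) (B' B) := by
        ext a i
        refine Fin.addCases (fun a => ?_) (fun a => ?_) a
        · simp
        · simp [B', Fin.init]
      rw [← Fin.append_snoc, ← hB] at h1
      have h3 := hdet (fun a => H (B (Fin.last k)) *ᵥ v a) (B' B)
      rw [← h2] at h3
      refine h1.trans ?_
      rw [abs_mul, abs_of_nonneg (Real.sqrt_nonneg _), mul_assoc]
      congr 1
      refine h3.trans ?_
      simp only [Matrix.mulVec_mulVec]

end Householder

/-! ### Integrals of absolute values of decomposable forms are normal -/

section Crofton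

variable {V : Type*} [NormedAddCommGroup V] [NormedSpace ℝ V] {m : ℕ}

/-- The determinant `det (Aᵢ (ξₐ))`, i.e. the `m`-form `A₁ ∧ … ∧ Aₘ`. -/
def detForm {W : Type*} [AddCommGroup W] [Module ℝ W] (A : W →ₗ[ℝ] (Fin m → ℝ)) :
    W [⋀^Fin m]→ₗ[ℝ] ℝ :=
  (Matrix.detRowAlternating (R := ℝ) (n := Fin m)).compLinearMap A

theorem detForm_apply {W : Type*} [AddCommGroup W] [Module ℝ W] (A : W →ₗ[ℝ] (Fin m → ℝ))
    (ξ : Fin m → W) : detForm A ξ = (Matrix.of fun i a => A (ξ a) i).det := by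
  rw [← Matrix.det_transpose]
  rfl

/-- A finite measure of bounded support on the tuples of covectors, and the average of
`|A₁ ∧ … ∧ Aₘ|` with respect to it. -/
def IsCrofton (δ : (Fin m → V) → ℝ) : Prop :=
  ∃ ν : Measure (V →L[ℝ] (Fin m → ℝ)), IsFiniteMeasure ν ∧ (∃ C, ∀ᵐ A ∂ν, ‖A‖ ≤ C) ∧
    ∀ ξ, δ ξ = ∫ A, |detForm A.toLinearMap ξ| ∂ν

theorem continuous_detForm (ξ : Fin m → V) :
    Continuous fun A : V →L[ℝ] (Fin m → ℝ) => detForm A.toLinearMap ξ := by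
  simp only [detForm_apply]
  refine Continuous.matrix_det (continuous_matrix fun i a => ?_)
  exact (continuous_apply i).comp (ContinuousLinearMap.apply ℝ (Fin m → ℝ) (ξ a)).continuous

theorem detForm_eq_zero_of_not_surjective {A : V →L[ℝ] (Fin m → ℝ)} (hA : ¬Function.Surjective A)
    (ξ : Fin m → V) : detForm A.toLinearMap ξ = 0 := by
  by_contra h
  rw [detForm_apply] at h
  refine hA fun b => ?_
  set N := Matrix.of fun i a => A.toLinearMap (ξ a) i with hN
  refine ⟨∑ a, (N⁻¹.mulVec b) a • ξ a, ?_⟩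
  have h1 : A (∑ a, (N⁻¹.mulVec b) a • ξ a) = N.mulVec (N⁻¹.mulVec b) := by
    rw [map_sum]
    ext i
    simp only [map_smul, Finset.sum_apply, Pi.smul_apply, smul_eq_mul, Matrix.mulVec, dotProduct]
    refine Finset.sum_congr rfl fun a _ => mul_comm _ _
  rw [h1, Matrix.mulVec_mulVec, Matrix.mul_nonsing_inv _ (isUnit_iff_ne_zero.2 h),
    Matrix.one_mulVec]

theorem volume_image_parallelepiped (A : V →L[ℝ] (Fin m → ℝ)) (ξ : Fin m → V) :
    volume (A '' parallelepiped ξ) = ENNReal.ofReal |detForm A.toLinearMap ξ| := by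
  have h := image_parallelepiped A.toLinearMap ξ
  change A '' parallelepiped ξ = _ at h
  rw [h]
  have h2 := Measure.addHaar_parallelepiped (Pi.basisFun ℝ (Fin m)) (A.toLinearMap ∘ ξ)
  rw [Module.Basis.addHaar_def, Module.Basis.parallelepiped_basisFun, addHaarMeasure_eq_volume_pi] at h2
  rw [h2, Pi.basisFun_det]
  rfl

theorem IsCrofton.isHomogeneousDensity {δ : (Fin m → V) → ℝ} (h : IsCrofton δ) :
    IsHomogeneousDensity δ := by
  obtain ⟨ν, -, -, hδ⟩ := h
  intro t ξ ξ' hξ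
  rw [hδ, hδ, ← integral_const_mul]
  congr 1 with A
  have h1 := congrArg (exteriorPower.alternatingMapLinearEquiv (detForm A.toLinearMap)) hξ
  rw [map_smul, exteriorPower.alternatingMapLinearEquiv_apply_ιMulti,
    exteriorPower.alternatingMapLinearEquiv_apply_ιMulti] at h1
  rw [h1, smul_eq_mul, abs_mul]

theorem isCrofton_zero : IsCrofton (fun _ : Fin m → V => (0 : ℝ)) :=
  ⟨0, inferInstance, ⟨0, by simp⟩, by simp⟩

/-- Linear maps onto `ℝᵐ`. -/
abbrev Submersion (m : ℕ) (V : Type*) [NormedAddCommGroup V] [NormedSpace ℝ V] : Type _ :=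
  {A : V →L[ℝ] (Fin m → ℝ) // Function.Surjective A}

/-- A locally defined continuous solution of the linear system `A v = b`. -/
theorem exists_local_solution (A₀ : V →L[ℝ] (Fin m → ℝ)) (h : Function.Surjective A₀) (v₀ : V) :
    ∃ g : (V →L[ℝ] (Fin m → ℝ)) × (Fin m → ℝ) → V, ContinuousAt g (A₀, A₀ v₀) ∧
      g (A₀, A₀ v₀) = v₀ ∧ ∀ᶠ z in 𝓝 (A₀, A₀ v₀), z.1 (g z) = z.2 := by
  obtain ⟨r, hr⟩ := A₀.toLinearMap.exists_rightInverse_of_surjective (LinearMap.range_eq_top.2 h)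
  let r' : (Fin m → ℝ) →L[ℝ] V := LinearMap.toContinuousLinearMap r
  have hr' : A₀ ∘L r' = ContinuousLinearMap.id ℝ _ := by
    ext1 b
    exact LinearMap.congr_fun hr b
  have hcomp : Continuous fun z : (V →L[ℝ] (Fin m → ℝ)) × (Fin m → ℝ) => z.1 ∘L r' := by fun_prop
  have hone : IsUnit (A₀ ∘L r') := by rw [hr']; exact isUnit_one
  refine ⟨fun z => v₀ + r' (Ring.inverse (z.1 ∘L r') (z.2 - z.1 v₀)), ?_, ?_, ?_⟩
  · have hinv : ContinuousAt (fun z : (V →L[ℝ] (Fin m → ℝ)) × (Fin m → ℝ) =>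
        Ring.inverse (z.1 ∘L r')) (A₀, A₀ v₀) :=
      ContinuousAt.comp_of_eq (f := fun z : (V →L[ℝ] (Fin m → ℝ)) × (Fin m → ℝ) => z.1 ∘L r')
        (NormedRing.inverse_continuousAt hone.unit) hcomp.continuousAt rfl
    have h2 : ContinuousAt (fun z : (V →L[ℝ] (Fin m → ℝ)) × (Fin m → ℝ) => z.2 - z.1 v₀)
      (A₀, A₀ v₀) := by fun_prop
    exact continuousAt_const.add (r'.continuous.continuousAt.comp (hinv.clm_apply h2))
  · simp
  · have hopen : ∀ᶠ z : (V →L[ℝ] (Fin m → ℝ)) × (Fin m → ℝ) in 𝓝 (A₀, A₀ v₀),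
        IsUnit (z.1 ∘L r') :=
      hcomp.continuousAt.eventually (Units.isOpen.mem_nhds hone)
    filter_upwards [hopen] with z hz
    have := Ring.mul_inverse_cancel _ hz
    have h3 := DFunLike.congr_fun this (z.2 - z.1 v₀)
    change z.1 (r' (Ring.inverse (z.1 ∘L r') (z.2 - z.1 v₀))) = z.2 - z.1 v₀ at h3
    rw [map_add, h3]
    abel

theorem isOpen_setOf_surjective :
    IsOpen {A : V →L[ℝ] (Fin m → ℝ) | Function.Surjective A} := by
  refine isOpen_iff_mem_nhds.2 fun A₀ (h : Function.Surjective A₀) => ?_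
  obtain ⟨r, hr⟩ := A₀.toLinearMap.exists_rightInverse_of_surjective (LinearMap.range_eq_top.2 h)
  let r' : (Fin m → ℝ) →L[ℝ] V := LinearMap.toContinuousLinearMap r
  have hone : IsUnit (A₀ ∘L r') := by
    have hr' : A₀ ∘L r' = ContinuousLinearMap.id ℝ _ := by
      ext1 b
      exact LinearMap.congr_fun hr b
    rw [hr']; exact isUnit_one
  have hcomp : Continuous fun A : V →L[ℝ] (Fin m → ℝ) => A ∘L r' := by fun_prop
  filter_upwards [hcomp.continuousAt.eventually (Units.isOpen.mem_nhds hone)] with A hA b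
  exact ⟨r' (Ring.inverse (A ∘L r') b), DFunLike.congr_fun (Ring.mul_inverse_cancel _ hA) b⟩

variable [FiniteDimensional ℝ V]

theorem integrable_abs_detForm {ν : Measure (V →L[ℝ] (Fin m → ℝ))} [IsFiniteMeasure ν] {C : ℝ}
    (hC : ∀ᵐ A ∂ν, ‖A‖ ≤ C) (ξ : Fin m → V) :
    Integrable (fun A => |detForm A.toLinearMap ξ|) ν := by
  have hc := (continuous_detForm ξ).abs
  obtain ⟨D, hD⟩ := (isCompact_closedBall (0 : V →L[ℝ] (Fin m → ℝ)) C).exists_bound_of_continuousOn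
    hc.continuousOn
  refine Integrable.of_bound hc.aestronglyMeasurable D (hC.mono fun A hA => hD A ?_)
  simpa using hA

theorem AGr.continuous_solutions :
    Continuous (AGr.solutions : Submersion m V × (Fin m → ℝ) → AGr m V) :=
  continuous_coinduced_rng

theorem AGr.solutions_mem_meeting (D : Set V) (z : Submersion m V × (Fin m → ℝ)) :
    AGr.solutions z ∈ AGr.meeting m D ↔ z.2 ∈ z.1.1 '' D := by
  constructor
  · rintro ⟨v, hv, hD⟩
    exact ⟨v, hD, (AGr.mem_solutions z v).1 hv⟩
  · rintro ⟨v, hD, hv⟩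
    exact ⟨v, (AGr.mem_solutions z v).2 hv, hD⟩

theorem AGr.isOpen_meeting {D : Set V} (hD : IsOpen D) : IsOpen (AGr.meeting m D) := by
  rw [isOpen_coinduced]
  refine isOpen_iff_mem_nhds.2 ?_
  rintro ⟨⟨A₀, hA₀⟩, b₀⟩ h
  obtain ⟨v₀, hv₀, hb⟩ := (AGr.solutions_mem_meeting D _).1 h
  obtain rfl : A₀ v₀ = b₀ := hb
  obtain ⟨g, hg, hg₀, hsol⟩ := exists_local_solution A₀ hA₀ v₀
  have hι : ContinuousAt (fun z : Submersion m V × (Fin m → ℝ) => (z.1.1, z.2))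
    (⟨A₀, hA₀⟩, A₀ v₀) := by fun_prop
  have hgD := hι.eventually (hg.eventually (by rw [hg₀]; exact hD.mem_nhds hv₀))
  filter_upwards [hgD, hι.eventually hsol] with z h1 h2
  exact (AGr.solutions_mem_meeting D z).2 ⟨_, h1, h2⟩

theorem AGr.isClosed_meeting {D : Set V} (hD : IsCompact D) : IsClosed (AGr.meeting m D) := by
  rw [isClosed_coinduced]
  have : AGr.solutions ⁻¹' AGr.meeting m D =
      Prod.fst '' {q : (Submersion m V × (Fin m → ℝ)) × D | q.1.1.1 q.2 = q.1.2} := by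
    ext z
    rw [Set.mem_preimage, AGr.solutions_mem_meeting]
    constructor
    · rintro ⟨v, hv, h⟩
      exact ⟨(z, ⟨v, hv⟩), h, rfl⟩
    · rintro ⟨⟨z', v⟩, h, rfl⟩
      exact ⟨v, v.2, h⟩
  rw [this]
  have : CompactSpace D := isCompact_iff_compactSpace.1 hD
  refine isClosedMap_fst_of_compactSpace _ (isClosed_eq ?_ ?_) <;> fun_prop

theorem AGr.translate_solutions (v : V) (z : Submersion m V × (Fin m → ℝ)) :
    AGr.translate v (AGr.solutions z) = AGr.solutions (z.1, z.2 + z.1.1 v) := by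
  refine Subtype.ext (SetLike.ext fun x => ?_)
  rw [AGr.mem_solutions]
  change x ∈ (AGr.solutions z).1.map (AffineEquiv.constVAdd ℝ V v).toAffineMap ↔ _
  rw [AffineSubspace.mem_map]
  constructor
  · rintro ⟨y, hy, rfl⟩
    rw [AGr.mem_solutions] at hy
    simp [hy, add_comm]
  · intro h
    refine ⟨x - v, (AGr.mem_solutions _ _).2 ?_, by simp⟩
    rw [map_sub, h]
    simp

theorem AGr.continuous_translate (v : V) : Continuous (AGr.translate v : AGr m V → AGr m V) := by
  refine continuous_coinduced_dom.2 ?_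
  have : AGr.translate v ∘ AGr.solutions = fun z : Submersion m V × (Fin m → ℝ) =>
      AGr.solutions (z.1, z.2 + z.1.1 v) := funext (AGr.translate_solutions v)
  rw [this]
  have h : Continuous fun z : Submersion m V × (Fin m → ℝ) => (z.1, z.2 + z.1.1 v) :=
    continuous_fst.prodMk (continuous_snd.add (by fun_prop))
  exact AGr.continuous_solutions.comp h

/-- The measure on `AGrᵐ(V)` obtained by averaging the images of Lebesgue measure under
`b ↦ {v | A v = b}` over `A`. -/
noncomputable def croftonMeasure (ν : Measure (Submersion m V)) : Measure (AGr m V) :=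
  (ν.prod volume).map AGr.solutions

theorem croftonMeasure_meeting (ν : Measure (Submersion m V)) {D : Set V}
    (hD : MeasurableSet (AGr.meeting m D)) :
    croftonMeasure ν (AGr.meeting m D) = ∫⁻ A, volume (A.1 '' D) ∂ν := by
  rw [croftonMeasure, Measure.map_apply AGr.continuous_solutions.measurable hD,
    Measure.prod_apply (AGr.continuous_solutions.measurable hD)]
  congr 1 with A
  congr 1
  ext b
  exact AGr.solutions_mem_meeting D (A, b)

theorem isNormalMeasure_croftonMeasure (ν : Measure (Submersion m V)) [IsFiniteMeasure ν] {C : ℝ}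
    (hC : ∀ᵐ A ∂ν, ‖A.1‖ ≤ C) : IsNormalMeasure (croftonMeasure ν) where
  finite_on_compacts K hK := by
    have hcov : K ⊆ ⋃ R : ℕ, AGr.meeting m (Metric.ball (0 : V) R) := by
      intro H _
      obtain ⟨v, hv⟩ := H.2.1
      obtain ⟨R, hR⟩ := exists_nat_gt ‖v‖
      exact Set.mem_iUnion.2 ⟨R, v, hv, by simpa using hR⟩
    have hdir : Directed (· ⊆ ·) fun R : ℕ => AGr.meeting m (Metric.ball (0 : V) R) := by
      refine directed_of_isDirected_le fun R S hRS H hH => ?_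
      exact hH.mono (Set.inter_subset_inter_right _ (Metric.ball_subset_ball (by exact_mod_cast hRS)))
    obtain ⟨R, hR⟩ := hK.elim_directed_cover _ (fun R => AGr.isOpen_meeting Metric.isOpen_ball)
      hcov hdir
    refine (measure_mono hR).trans_lt ?_
    rw [croftonMeasure_meeting ν (AGr.isOpen_meeting Metric.isOpen_ball).measurableSet]
    calc ∫⁻ A, volume (A.1 '' Metric.ball 0 R) ∂ν
        ≤ ∫⁻ A, volume (Metric.closedBall (0 : Fin m → ℝ) (C * R)) ∂ν := by
          refine lintegral_mono_ae (hC.mono fun A hA => measure_mono ?_)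
          rintro _ ⟨v, hv, rfl⟩
          rw [mem_closedBall_zero_iff]
          rw [mem_ball_zero_iff] at hv
          exact (A.1.le_opNorm v).trans
            (mul_le_mul hA hv.le (norm_nonneg _) ((norm_nonneg _).trans hA))
      _ < ⊤ := by
          rw [lintegral_const]
          exact ENNReal.mul_lt_top measure_closedBall_lt_top (measure_lt_top _ _)
  translation_invariant v B hB := by
    have hT := (AGr.continuous_translate (m := m) v).measurable
    have hS := (AGr.continuous_solutions (m := m) (V := V)).measurable
    rw [croftonMeasure, Measure.map_apply hS (hT hB), Measure.map_apply hS hB,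
      Measure.prod_apply (hS (hT hB)), Measure.prod_apply (hS hB)]
    congr 1 with A
    have : Prod.mk A ⁻¹' (AGr.solutions ⁻¹' (AGr.translate v ⁻¹' B)) =
        (fun b => b + A.1 v) ⁻¹' (Prod.mk A ⁻¹' (AGr.solutions ⁻¹' B)) := by
      ext b
      simp only [Set.mem_preimage, AGr.translate_solutions]
    rw [this, measure_preimage_add_right]

theorem isNormalMeasure_zero : IsNormalMeasure (0 : Measure (AGr m V)) where
  finite_on_compacts K _ := by simp
  translation_invariant v B _ := by simp

theorem IsCrofton.isNormal {δ : (Fin m → V) → ℝ} (h : IsCrofton δ) : IsNormal δ := by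
  obtain ⟨ν, hν, ⟨C, hC⟩, hδ⟩ := h
  have hS : MeasurableSet {A : V →L[ℝ] (Fin m → ℝ) | Function.Surjective A} :=
    isOpen_setOf_surjective.measurableSet
  let ν' : Measure (Submersion m V) := ν.comap Subtype.val
  have hν' : IsFiniteMeasure ν' := by
    refine ⟨?_⟩
    have h := comap_subtype_coe_apply hS ν Set.univ
    change ν' Set.univ = _ at h
    rw [h]
    exact measure_lt_top _ _
  have hC' : ∀ᵐ A ∂ν', ‖A.1‖ ≤ C := by
    have := ae_restrict_of_ae (s := {A : V →L[ℝ] (Fin m → ℝ) | Function.Surjective A}) hC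
    rwa [← map_comap_subtype_coe hS, ae_map_iff measurable_subtype_coe.aemeasurable
      (measurableSet_le measurable_norm measurable_const)] at this
  refine ⟨croftonMeasure ν', 0, isNormalMeasure_croftonMeasure ν' hC', isNormalMeasure_zero,
    fun ξ => ?_⟩
  have hcpt : IsCompact (parallelepiped ξ) := by
    rw [parallelepiped]
    exact isCompact_Icc.image (by fun_prop)
  rw [measureReal_def, croftonMeasure_meeting ν' (AGr.isClosed_meeting hcpt).measurableSet, hδ ξ,
    ← setIntegral_eq_integral_of_forall_compl_eq_zero (s := {A : V →L[ℝ] (Fin m → ℝ) | Function.Surjective A})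
      (fun A hA => by rw [detForm_eq_zero_of_not_surjective hA, abs_zero]),
    ← integral_subtype_comap hS, integral_eq_lintegral_of_nonneg_ae
      (Filter.Eventually.of_forall fun A => abs_nonneg _)
      ((continuous_detForm ξ).abs.comp continuous_subtype_val).aestronglyMeasurable]
  simp only [volume_image_parallelepiped]
  simp [ν']

theorem IsCrofton.add {δ₁ δ₂ : (Fin m → V) → ℝ} (h₁ : IsCrofton δ₁) (h₂ : IsCrofton δ₂) :
    IsCrofton (fun ξ => δ₁ ξ + δ₂ ξ) := by
  obtain ⟨ν₁, hν₁, ⟨C₁, hC₁⟩, hδ₁⟩ := h₁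
  obtain ⟨ν₂, hν₂, ⟨C₂, hC₂⟩, hδ₂⟩ := h₂
  refine ⟨ν₁ + ν₂, inferInstance, ⟨max C₁ C₂, ?_⟩, fun ξ => ?_⟩
  · rw [ae_add_measure_iff]
    exact ⟨hC₁.mono fun A h => h.trans (le_max_left _ _),
      hC₂.mono fun A h => h.trans (le_max_right _ _)⟩
  · rw [integral_add_measure (integrable_abs_detForm hC₁ ξ) (integrable_abs_detForm hC₂ ξ),
      ← hδ₁, ← hδ₂]

theorem isCrofton_sum {ι : Type*} (s : Finset ι) {δ : ι → (Fin m → V) → ℝ}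
    (h : ∀ i ∈ s, IsCrofton (δ i)) : IsCrofton (fun ξ => ∑ i ∈ s, δ i ξ) := by
  classical
  induction s using Finset.induction_on with
  | empty => simpa using isCrofton_zero
  | insert i s hi ih =>
    simp only [Finset.sum_insert hi]
    exact (h i (Finset.mem_insert_self i s)).add
      (ih fun l hl => h l (Finset.mem_insert_of_mem hl))

/-- A weighted average, over a finite measure space, of `|ψ₁ ∧ … ∧ ψₘ|` with bounded covector
fields `ψᵢ` given by their components in a basis. -/
theorem isCrofton_integral {Ω ι : Type*} [Fintype ι] [MeasurableSpace Ω] (ν : Measure Ω)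
    [IsFiniteMeasure ν] (b : Module.Basis ι ℝ V) {w : Ω → ℝ} (hw : AEMeasurable w ν) {D : ℝ}
    (hD : ∀ᵐ q ∂ν, |w q| ≤ D) {ψ : Ω → V →L[ℝ] (Fin m → ℝ)}
    (hψ : ∀ a i, AEMeasurable (fun q => ψ q (b a) i) ν) {C : ℝ}
    (hC : ∀ᵐ q ∂ν, ∀ a i, |ψ q (b a) i| ≤ C) :
    IsCrofton (fun ξ => ∫ q, |w q| * |detForm (ψ q).toLinearMap ξ| ∂ν) := by
  classical
  let F : ι → Fin m → V →L[ℝ] (Fin m → ℝ) := fun a i =>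
    (LinearMap.toContinuousLinearMap (b.coord a)).smulRight (Pi.single i (1 : ℝ))
  have hF : ∀ q, ψ q = ∑ a, ∑ i, ψ q (b a) i • F a i := by
    intro q
    refine ContinuousLinearMap.coe_injective (b.ext fun c => ?_)
    ext l
    simp only [F, Finset.sum_apply, Finsupp.single_apply, Pi.single_apply, ContinuousLinearMap.coe_coe,
      _root_.sum_apply, _root_.smul_apply, Pi.smul_apply, smul_eq_mul,
      ContinuousLinearMap.smulRight_apply, LinearMap.coe_toContinuousLinearMap',
      Module.Basis.coord_apply, Module.Basis.repr_self]
    simp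
  have hψm : AEMeasurable ψ ν := by
    have : ψ = fun q => ∑ a, ∑ i, ψ q (b a) i • F a i := funext hF
    rw [this]
    exact Finset.aemeasurable_fun_sum _ fun a _ => Finset.aemeasurable_fun_sum _ fun i _ =>
      (hψ a i).smul_const _
  let ν₁ : Measure Ω := ν.withDensity fun q => ENNReal.ofReal |w q|
  have hwm : AEMeasurable (fun q => ENNReal.ofReal |w q|) ν := by fun_prop
  have hν₁ : IsFiniteMeasure ν₁ := by
    refine isFiniteMeasure_withDensity ?_
    refine ne_top_of_le_ne_top (b := ENNReal.ofReal D * ν Set.univ)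
      (ENNReal.mul_ne_top ENNReal.ofReal_ne_top (measure_ne_top _ _)) ?_
    rw [← lintegral_const]
    exact lintegral_mono_ae (hD.mono fun q h => ENNReal.ofReal_le_ofReal h)
  have hac : ν₁ ≪ ν := withDensity_absolutelyContinuous _ _
  refine ⟨ν₁.map ψ, inferInstance, ⟨∑ a, ∑ i, C * ‖F a i‖, ?_⟩, fun ξ => ?_⟩
  · rw [ae_map_iff (hψm.mono_ac hac) (measurableSet_le measurable_norm measurable_const)]
    filter_upwards [hac.ae_le hC] with q hq
    rw [hF q]
    refine (norm_sum_le _ _).trans (Finset.sum_le_sum fun a _ => (norm_sum_le _ _).trans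
      (Finset.sum_le_sum fun i _ => ?_))
    rw [norm_smul]
    exact mul_le_mul_of_nonneg_right (hq a i) (norm_nonneg _)
  · rw [integral_map (hψm.mono_ac hac) (continuous_detForm ξ).abs.aestronglyMeasurable]
    simp only [ν₁]
    rw [integral_withDensity_eq_integral_toReal_smul₀ hwm
      (Filter.Eventually.of_forall fun _ => ENNReal.ofReal_lt_top)]
    simp [ENNReal.toReal_ofReal]

end Crofton

/-! ### Absolute values of decomposable forms -/

section Decomposable

theorem append_comp_update {j k : ℕ} {U W : Type*} [DecidableEq (Fin k)] (ξ : Fin j → W) (T : U → W)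
    (t : Fin k → U) (a : Fin k) (z : U) :
    (Fin.append ξ fun b => T (Function.update t a z b)) =
      Function.update (Fin.append ξ fun b => T (t b)) (Fin.natAdd j a) (T z) := by
  ext b
  refine Fin.addCases (fun b => ?_) (fun b => ?_) b
  · rw [Fin.append_left, Function.update_of_ne, Fin.append_left]
    simp [Fin.ext_iff]; omega
  · rw [Fin.append_right]
    by_cases hb : b = a
    · subst hb; simp
    · rw [Function.update_of_ne hb, Function.update_of_ne, Fin.append_right]
      simpa using hb

variable {W : Type*} [AddCommGroup W] [Module ℝ W] {j k m : ℕ}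

/-- The absolute value of a decomposable `m`-form on a vector space. -/
def IsDecomposable (δ : (Fin m → W) → ℝ) : Prop :=
  ∃ (c : ℝ) (A : W →ₗ[ℝ] (Fin m → ℝ)), ∀ ξ, δ ξ = |c * detForm A ξ|

theorem IsDecomposable.append_congr {δ : (Fin (j + k) → W) → ℝ} (h : IsDecomposable δ)
    {ξ ξ' : Fin j → W} {f : Fin k → W} (hξ : ∀ i, ξ i - ξ' i ∈ Submodule.span ℝ (Set.range f)) :
    δ (Fin.append ξ f) = δ (Fin.append ξ' f) := by
  obtain ⟨c, A, hδ⟩ := h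
  obtain ⟨G, w, -, -, -, -, hG, hdet⟩ := exists_reduction j k
  have key : ∀ ξ : Fin j → W, |detForm A (Fin.append ξ f)| =
      |w (A ∘ f)| * |(Matrix.of fun i a => (G (A ∘ f)).mulVec (A (ξ a)) i).det| := by
    intro ξ
    refine Eq.trans ?_ (hdet (A ∘ ξ) (A ∘ f))
    rw [detForm_apply]
    congr 3
    ext i a
    refine Fin.addCases (fun a => ?_) (fun a => ?_) a <;> simp
  rw [hδ, hδ, abs_mul, abs_mul, key, key]
  congr 5
  ext i a
  have hker : Submodule.span ℝ (Set.range f) ≤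
      LinearMap.ker ((G (A ∘ f)).mulVecLin ∘ₗ A) := by
    rw [Submodule.span_le]
    rintro _ ⟨b, rfl⟩
    exact hG (A ∘ f) b
  have h0 := hker (hξ a)
  rw [LinearMap.mem_ker, map_sub, sub_eq_zero] at h0
  exact congrFun h0 i

/-- An alternating form on `W`, with the first arguments fixed and the others transported from `U`. -/
def appendAlternating {U : Type*} [AddCommGroup U] [Module ℝ U]
    (g : W [⋀^Fin (j + k)]→ₗ[ℝ] ℝ) (ξ : Fin j → W) (T : U →ₗ[ℝ] W) : U [⋀^Fin k]→ₗ[ℝ] ℝ where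
  toFun t := g (Fin.append ξ fun a => T (t a))
  map_update_add' t a x y := by
    simp only [append_comp_update, map_add, AlternatingMap.map_update_add]
  map_update_smul' t a c x := by
    simp only [append_comp_update, map_smul, AlternatingMap.map_update_smul]
  map_eq_zero_of_eq' t a b hab hne := by
    refine g.map_eq_zero_of_eq _ (i := Fin.natAdd j a) (j := Fin.natAdd j b) ?_ ?_
    · simp [hab]
    · simpa using hne

theorem IsDecomposable.append_comp {U : Type*} [AddCommGroup U] [Module ℝ U]
    {δ : (Fin (j + k) → W) → ℝ} (h : IsDecomposable δ) (ξ : Fin j → W) (T : U →ₗ[ℝ] W)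
    (e : Module.Basis (Fin k) ℝ U) (L : U →ₗ[ℝ] U) :
    δ (Fin.append ξ fun a => T (L (e a))) =
      |LinearMap.det L| * δ (Fin.append ξ fun a => T (e a)) := by
  obtain ⟨c, A, hδ⟩ := h
  have key : detForm A (Fin.append ξ fun a => T (L (e a))) =
      LinearMap.det L * detForm A (Fin.append ξ fun a => T (e a)) := by
    change appendAlternating (detForm A) ξ T (L ∘ e) =
      _ * appendAlternating (detForm A) ξ T e
    have h1 := (appendAlternating (detForm A) ξ T).eq_smul_basis_det e
    have h2 := DFunLike.congr_fun h1 (L ∘ e)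
    rw [AlternatingMap.smul_apply, e.det_comp, e.det_self, mul_one, smul_eq_mul] at h2
    rw [h2, mul_comm]
  rw [hδ, hδ, key, abs_mul, abs_mul, abs_mul]
  ring

end Decomposable

/-! ### The integral of a density does not change under diffeomorphisms -/

section DensityIntegral

variable {k : ℕ} {F : Type*} [TopologicalSpace F] [ChartedSpace (E k) F]

/-- The coefficient of a top-order density in the preferred chart at `i`. -/
noncomputable def chartCoeff (σ : TupleFunction k k F) (i : F) (u : E k) : ℝ :=
  σ ((chartAt (E k) i).symm u)
    (fun a => mfderiv (𝓡 k) (𝓡 k) (chartAt (E k) i).symm u (EuclideanSpace.single a (1 : ℝ) : E k))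

theorem TupleFunction.congr_point {d m : ℕ} {X : Type*} [TopologicalSpace X] [ChartedSpace (E d) X]
    (σ : TupleFunction d m X) {z z' : X} (hz : z = z') {f f' : Fin m → E d} (hf : f = f') :
    σ z f = σ z' f' := by
  subst hz hf
  rfl

variable [IsManifold (𝓡 k) ∞ F] [T2Space F] [CompactSpace F]

theorem chartPartition_subordinate :
    (chartPartition k F).IsSubordinate fun i => (chartAt (E k) i).source :=
  (SmoothPartitionOfUnity.exists_isSubordinate_chartAt_source (𝓡 k) F).choose_spec

variable (k F) in
theorem finite_chartPartition : {i : F | (Function.support (chartPartition k F i)).Nonempty}.Finite :=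
  (chartPartition k F).locallyFinite.finite_nonempty_of_compact

variable (k F) in
/-- The finitely many charts that contribute to the integral of a density. -/
noncomputable def chartIndices : Finset F := (finite_chartPartition k F).toFinset

theorem chartPartition_eq_zero {i : F} (hi : i ∉ chartIndices k F) (z : F) :
    chartPartition k F i z = 0 := by
  by_contra h
  exact hi ((finite_chartPartition k F).mem_toFinset.2 ⟨z, h⟩)

theorem sum_chartPartition (z : F) : ∑ i ∈ chartIndices k F, chartPartition k F i z = 1 := by
  rw [← (chartPartition k F).sum_eq_one (Set.mem_univ z)]
  refine (finsum_eq_sum_of_support_subset _ fun i hi => ?_).symm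
  exact (finite_chartPartition k F).mem_toFinset.2 ⟨z, hi⟩

theorem densityIntegral_eq_sum (σ : TupleFunction k k F) :
    densityIntegral σ = ∑ i ∈ chartIndices k F, ∫ u in (chartAt (E k) i).target,
      chartPartition k F i ((chartAt (E k) i).symm u) * chartCoeff σ i u := by
  refine finsum_eq_sum_of_support_subset _ fun i hi => ?_
  by_contra h
  exact hi (by simp [chartPartition_eq_zero h])

/-- The support of a function of the partition of unity, in its chart. -/
def chartSupport (i : F) : Set (E k) :=
  chartAt (E k) i '' tsupport (chartPartition k F i)

theorem isCompact_chartSupport (i : F) : IsCompact (chartSupport (k := k) i) :=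
  (isClosed_tsupport _).isCompact.image_of_continuousOn
    ((chartAt (E k) i).continuousOn.mono (chartPartition_subordinate i))

theorem chartSupport_subset (i : F) : chartSupport (k := k) i ⊆ (chartAt (E k) i).target := by
  rintro _ ⟨z, hz, rfl⟩
  exact (chartAt (E k) i).map_source (chartPartition_subordinate i hz)

theorem chartPartition_eq_zero_of_notMem {i : F} {u : E k} (hu : u ∈ (chartAt (E k) i).target)
    (h : u ∉ chartSupport (k := k) i) :
    chartPartition k F i ((chartAt (E k) i).symm u) = 0 := by
  by_contra h0
  exact h ⟨_, subset_tsupport _ h0, (chartAt (E k) i).right_inv hu⟩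

theorem continuousOn_chartPartition (i : F) : ContinuousOn
    (fun u => chartPartition k F i ((chartAt (E k) i).symm u)) (chartAt (E k) i).target :=
  (chartPartition k F i).contMDiff.continuous.comp_continuousOn
    (chartAt (E k) i).continuousOn_symm

theorem integrableOn_chartPartition_mul {i : F} {h : E k → ℝ}
    (hh : ContinuousOn h (chartAt (E k) i).target) :
    IntegrableOn (fun u => chartPartition k F i ((chartAt (E k) i).symm u) * h u)
      (chartAt (E k) i).target := by
  refine IntegrableOn.of_forall_sdiff_eq_zero (s := chartSupport i) ?_
    (chartAt (E k) i).open_target.measurableSet fun u hu => ?_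
  · exact (((continuousOn_chartPartition i).mul hh).mono (chartSupport_subset i)).integrableOn_compact
      (isCompact_chartSupport i)
  · rw [chartPartition_eq_zero_of_notMem hu.1 hu.2, zero_mul]

/-- The contribution of a pair of charts, `i` at `z` and `l` at `g z`, to the integral. -/
noncomputable def pairIntegral (σ : TupleFunction k k F) (g : F → F) (i l : F) : ℝ :=
  ∫ u in (chartAt (E k) i).target, chartPartition k F l (g ((chartAt (E k) i).symm u)) *
    (chartPartition k F i ((chartAt (E k) i).symm u) * chartCoeff σ i u)

theorem sum_pairIntegral {σ : TupleFunction k k F} {g : F → F} (hg : Continuous g) {i : F}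
    (hσ : ContinuousOn (chartCoeff σ i) (chartAt (E k) i).target) :
    ∑ l ∈ chartIndices k F, pairIntegral σ g i l = ∫ u in (chartAt (E k) i).target,
      chartPartition k F i ((chartAt (E k) i).symm u) * chartCoeff σ i u := by
  unfold pairIntegral
  rw [← integral_finsetSum]
  · congr 1 with u
    rw [← Finset.sum_mul, sum_chartPartition, one_mul]
  · intro l _
    have h1 : ContinuousOn (fun u => chartPartition k F l (g ((chartAt (E k) i).symm u)) *
        chartCoeff σ i u) (chartAt (E k) i).target :=
      (((chartPartition k F l).contMDiff.continuous.comp hg).comp_continuousOn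
        (chartAt (E k) i).continuousOn_symm).mul hσ
    have h2 := integrableOn_chartPartition_mul h1
    refine h2.congr_fun (fun u _ => ?_) (chartAt (E k) i).open_target.measurableSet
    dsimp only
    ring

theorem pairIntegral_comm {σ σ' : TupleFunction k k F} {g g' : F → F}
    (hg : MDifferentiable (𝓡 k) (𝓡 k) g) (hgc : Continuous g')
    (hl : ∀ z, g' (g z) = z) (hr : ∀ z, g (g' z) = z)
    (hσ : ∀ z f, σ' z f = σ (g z) fun a => mfderiv (𝓡 k) (𝓡 k) g z (f a))
    (hdet : ∀ (z : F) (T : E k →ₗ[ℝ] TangentSpace (𝓡 k) z) (L : E k →ₗ[ℝ] E k),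
      σ z (fun a => T (L (EuclideanSpace.single a 1))) =
        |LinearMap.det L| * σ z (fun a => T (EuclideanSpace.single a 1))) (i l : F) :
    pairIntegral σ' g i l = pairIntegral σ g' l i := by
  set κ := chartAt (E k) i with hκ
  set κ' := chartAt (E k) l with hκ'
  let S : Set (E k) := κ.target ∩ κ.symm ⁻¹' (g ⁻¹' κ'.source)
  let S' : Set (E k) := κ'.target ∩ κ'.symm ⁻¹' (g' ⁻¹' κ.source)
  have hSo : IsOpen S := κ.continuousOn_symm.isOpen_inter_preimage κ.open_target
    (hg.continuous.isOpen_preimage _ κ'.open_source)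
  have hSo' : IsOpen S' := κ'.continuousOn_symm.isOpen_inter_preimage κ'.open_target
    (hgc.isOpen_preimage _ κ.open_source)
  let τ : E k → E k := fun u => κ' (g (κ.symm u))
  have hτ : ∀ u ∈ S, κ'.symm (τ u) = g (κ.symm u) := fun u hu => κ'.left_inv hu.2
  have himg : τ '' S = S' := by
    ext u'
    constructor
    · rintro ⟨u, hu, rfl⟩
      refine ⟨κ'.map_source hu.2, ?_⟩
      rw [Set.mem_preimage, Set.mem_preimage, hτ u hu, hl]
      exact κ.map_target hu.1
    · rintro ⟨h1, h2⟩
      refine ⟨κ (g' (κ'.symm u')), ⟨κ.map_source h2, ?_⟩, ?_⟩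
      · rw [Set.mem_preimage, Set.mem_preimage, κ.left_inv h2, hr]
        exact κ'.map_target h1
      · change κ' (g (κ.symm (κ (g' (κ'.symm u'))))) = u'
        rw [κ.left_inv h2, hr, κ'.right_inv h1]
  have hinj : Set.InjOn τ S := by
    intro u hu v hv huv
    have h1 : g (κ.symm u) = g (κ.symm v) := by rw [← hτ u hu, ← hτ v hv, huv]
    have h2 : κ.symm u = κ.symm v := by rw [← hl (κ.symm u), h1, hl]
    rw [← κ.right_inv hu.1, h2, κ.right_inv hv.1]
  have hmκ : ∀ u ∈ κ.target, MDifferentiableAt (𝓡 k) (𝓡 k) κ.symm u := fun u hu =>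
    mdifferentiableAt_atlas_symm (chart_mem_atlas _ _) hu
  have hmτ : ∀ u ∈ S, MDifferentiableAt (𝓡 k) (𝓡 k) τ u := fun u hu =>
    (mdifferentiableAt_atlas (chart_mem_atlas _ _) hu.2).comp u
      ((hg _).comp u (hmκ u hu.1))
  let τ' : E k → E k →L[ℝ] E k := fun u => mfderiv (𝓡 k) (𝓡 k) τ u
  have hτ' : ∀ u ∈ S, HasFDerivWithinAt τ (τ' u) S u := fun u hu =>
    (hasMFDerivAt_iff_hasFDerivAt.1 (hmτ u hu).hasMFDerivAt).hasFDerivWithinAt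
  have hcoeff : ∀ u ∈ S, chartCoeff σ' i u = |(τ' u).det| * chartCoeff σ l (τ u) := by
    intro u hu
    have hτu : τ u ∈ κ'.target := κ'.map_source hu.2
    have hm' : MDifferentiableAt (𝓡 k) (𝓡 k) κ'.symm (τ u) :=
      mdifferentiableAt_atlas_symm (chart_mem_atlas _ _) hτu
    have h1 : HasMFDerivAt (𝓡 k) (𝓡 k) (g ∘ κ.symm) u _ :=
      (hg (κ.symm u)).hasMFDerivAt.comp u (hmκ u hu.1).hasMFDerivAt
    have h2 : HasMFDerivAt (𝓡 k) (𝓡 k) (κ'.symm ∘ τ) u _ :=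
      hm'.hasMFDerivAt.comp u (hmτ u hu).hasMFDerivAt
    have heq : g ∘ κ.symm =ᶠ[𝓝 u] κ'.symm ∘ τ := by
      filter_upwards [hSo.mem_nhds hu] with v hv
      exact (hτ v hv).symm
    have h3 := hasMFDerivAt_unique h1 (h2.congr_of_eventuallyEq heq)
    rw [chartCoeff, hσ]
    have h4 := hdet (κ'.symm (τ u)) (mfderiv (𝓡 k) (𝓡 k) κ'.symm (τ u)).toLinearMap
      (τ' u).toLinearMap
    refine Eq.trans ?_ h4
    refine σ.congr_point (hτ u hu).symm (funext fun a => ?_)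
    exact DFunLike.congr_fun h3 (EuclideanSpace.single a (1 : ℝ) : E k)
  unfold pairIntegral
  rw [← hκ, ← hκ', setIntegral_eq_of_subset_of_forall_sdiff_eq_zero κ.open_target.measurableSet
      (Set.inter_subset_left : S ⊆ κ.target),
    setIntegral_eq_of_subset_of_forall_sdiff_eq_zero κ'.open_target.measurableSet
      (Set.inter_subset_left : S' ⊆ κ'.target)]
  · change (∫ u in S, _) = ∫ u in S', _
    rw [← himg, integral_image_eq_integral_abs_det_fderiv_smul volume hSo.measurableSet hτ' hinj]
    refine setIntegral_congr_fun hSo.measurableSet fun u hu => ?_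
    simp only [hcoeff u hu, smul_eq_mul]
    rw [hτ u hu, hl]
    ring
  · intro u hu
    have h0 : chartPartition k F i (g' (κ'.symm u)) = 0 := by
      by_contra h
      exact hu.2 ⟨hu.1, chartPartition_subordinate i (subset_tsupport _ h)⟩
    rw [h0, zero_mul]
  · intro u hu
    have h0 : chartPartition k F l (g (κ.symm u)) = 0 := by
      by_contra h
      exact hu.2 ⟨hu.1, chartPartition_subordinate l (subset_tsupport _ h)⟩
    rw [h0, zero_mul]

/-- Change of variables for the integral of a density under a diffeomorphism `g`. -/
theorem densityIntegral_pullback {σ σ' : TupleFunction k k F} {g g' : F → F}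
    (hg : MDifferentiable (𝓡 k) (𝓡 k) g) (hgc : Continuous g')
    (hl : ∀ z, g' (g z) = z) (hr : ∀ z, g (g' z) = z)
    (hσ : ∀ z f, σ' z f = σ (g z) fun a => mfderiv (𝓡 k) (𝓡 k) g z (f a))
    (hdet : ∀ (z : F) (T : E k →ₗ[ℝ] TangentSpace (𝓡 k) z) (L : E k →ₗ[ℝ] E k),
      σ z (fun a => T (L (EuclideanSpace.single a 1))) =
        |LinearMap.det L| * σ z (fun a => T (EuclideanSpace.single a 1)))
    (hc : ∀ i, ContinuousOn (chartCoeff σ i) (chartAt (E k) i).target)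
    (hc' : ∀ i, ContinuousOn (chartCoeff σ' i) (chartAt (E k) i).target) :
    densityIntegral σ' = densityIntegral σ := by
  rw [densityIntegral_eq_sum, densityIntegral_eq_sum]
  simp only [← sum_pairIntegral hg.continuous (hc' _), ← sum_pairIntegral hgc (hc _)]
  rw [Finset.sum_comm]
  simp only [pairIntegral_comm hg hgc hl hr hσ hdet]

end DensityIntegral

/-! ### Coordinates along the fibers of a bundle -/

section Coordinates

variable {d n k j : ℕ} {X Y F : Type*}
  [TopologicalSpace X] [ChartedSpace (E d) X]
  [TopologicalSpace Y] [ChartedSpace (E n) Y]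
  [TopologicalSpace F] [ChartedSpace (E k) F] {p : X → Y}

/-- A local trivialization that is a diffeomorphism. -/
structure IsSmoothTrivialization (d n k : ℕ) {X Y F : Type*}
    [TopologicalSpace X] [ChartedSpace (E d) X] [TopologicalSpace Y] [ChartedSpace (E n) Y]
    [TopologicalSpace F] [ChartedSpace (E k) F] {p : X → Y} (e : Trivialization F p) : Prop where
  contMDiffOn : ContMDiffOn (𝓡 d) ((𝓡 n).prod (𝓡 k)) ∞ e e.source
  contMDiffOn_symm :
    ContMDiffOn ((𝓡 n).prod (𝓡 k)) (𝓡 d) ∞ e.toOpenPartialHomeomorph.symm e.target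

/-- The parametrization of the fiber over `y` by a local trivialization. -/
def fiberInclusion (e : Trivialization F p) (y : Y) (z : F) : X :=
  e.toOpenPartialHomeomorph.symm (y, z)

/-- The density `ξ ⌟ δ` on the fiber over `y`, transported to `F` by the parametrization `P`. -/
noncomputable def paramDensity (p : X → Y) (δ : TupleFunction d (j + k) X) (y : Y)
    (η : Fin j → TangentSpace (𝓡 n) y) (P : F → X) : TupleFunction k k F :=
  fun z f => δ (P z) (Fin.append (fun i => tangentLift d n p (P z) ⟨y, η i⟩)
    (fun a => mfderiv (𝓡 k) (𝓡 d) P z (f a)))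

/-- A local trivialization in the preferred chart of the fiber at `i`. -/
def coordMap (e : Trivialization F p) (i : F) (q : Y × E k) : X :=
  e.toOpenPartialHomeomorph.symm (q.1, (chartAt (E k) i).symm q.2)

/-- The domain of `coordMap`. -/
def coordDomain (e : Trivialization F p) (i : F) : Set (Y × E k) :=
  e.baseSet ×ˢ (chartAt (E k) i).target

theorem isOpen_coordDomain (e : Trivialization F p) (i : F) :
    IsOpen (coordDomain (k := k) e i) :=
  e.open_baseSet.prod (chartAt (E k) i).open_target

theorem proj_coordMap (e : Trivialization F p) (i : F) {q : Y × E k} (hq : q.1 ∈ e.baseSet) :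
    p (coordMap e i q) = q.1 :=
  e.proj_symm_apply' hq

theorem coordMap_mem_source (e : Trivialization F p) (i : F) {q : Y × E k}
    (hq : q.1 ∈ e.baseSet) : coordMap e i q ∈ e.source :=
  e.mem_source.2 (by rwa [proj_coordMap e i hq])

theorem apply_coordMap (e : Trivialization F p) (i : F) {q : Y × E k} (hq : q.1 ∈ e.baseSet) :
    e (coordMap e i q) = (q.1, (chartAt (E k) i).symm q.2) :=
  e.apply_symm_apply' hq

/-- The frame along the fibers that consists of the horizontal lifts of the vectors of `w` and of
the coordinate vector fields of the fiber. -/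
noncomputable def coordFrame (e : Trivialization F p) (i : F) (w : TangentTuple n j Y) (u : E k) :
    TangentTuple d (j + k) X where
  base := coordMap e i (w.base, u)
  vec := Fin.append
    (fun a => mfderiv ((𝓡 n).prod (𝓡 k)) (𝓡 d) (coordMap e i) (w.base, u)
      ((w.vec a, (0 : E k)) : E n × E k))
    (fun b => mfderiv ((𝓡 n).prod (𝓡 k)) (𝓡 d) (coordMap e i) (w.base, u)
      (((0 : E n), (EuclideanSpace.single b (1 : ℝ) : E k)) : E n × E k))

section Derivatives

variable {e : Trivialization F p}

theorem mdifferentiableAt_trivialization (he : IsSmoothTrivialization d n k e) {x : X}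
    (hx : x ∈ e.source) : MDifferentiableAt (𝓡 d) ((𝓡 n).prod (𝓡 k)) e x :=
  (he.contMDiffOn.contMDiffAt (e.open_source.mem_nhds hx)).mdifferentiableAt (by simp)

theorem mdifferentiableAt_proj (he : IsSmoothTrivialization d n k e) {x : X}
    (hx : x ∈ e.source) : MDifferentiableAt (𝓡 d) (𝓡 n) p x := by
  have h : MDifferentiableAt (𝓡 d) (𝓡 n) (Prod.fst ∘ e) x :=
    mdifferentiableAt_fst.comp x (mdifferentiableAt_trivialization he hx)
  refine h.congr_of_eventuallyEq ?_
  filter_upwards [e.open_source.mem_nhds hx] with x' hx'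
  exact (e.proj_toFun x' hx').symm

theorem mdifferentiableAt_fiberInclusion (he : IsSmoothTrivialization d n k e) {y : Y}
    (hy : y ∈ e.baseSet) (z : F) :
    MDifferentiableAt (𝓡 k) (𝓡 d) (fiberInclusion e y) z := by
  have hmem : (y, z) ∈ e.target := by
    rw [e.target_eq]
    exact ⟨hy, Set.mem_univ _⟩
  have h : MDifferentiableAt ((𝓡 n).prod (𝓡 k)) (𝓡 d) e.toOpenPartialHomeomorph.symm (y, z) :=
    (he.contMDiffOn_symm.contMDiffAt (e.open_target.mem_nhds hmem)).mdifferentiableAt (by simp)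
  exact h.comp z (mdifferentiableAt_const.prodMk mdifferentiableAt_id)

variable [IsManifold (𝓡 k) ∞ F]

theorem contMDiffOn_coordMap (he : IsSmoothTrivialization d n k e) (i : F) :
    ContMDiffOn ((𝓡 n).prod (𝓡 k)) (𝓡 d) ∞ (coordMap e i)
      (coordDomain (k := k) e i) := by
  refine he.contMDiffOn_symm.comp (t := e.target)
    (f := fun q : Y × E k => (q.1, (chartAt (E k) i).symm q.2)) ?_ ?_
  · exact contMDiffOn_fst.prodMk (contMDiffOn_chart_symm.comp contMDiffOn_snd fun q hq => hq.2)
  · intro q hq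
    rw [e.target_eq]
    exact ⟨hq.1, Set.mem_univ _⟩

theorem mdifferentiableAt_coordMap (he : IsSmoothTrivialization d n k e) (i : F) {q : Y × E k}
    (hq : q ∈ coordDomain e i) :
    MDifferentiableAt ((𝓡 n).prod (𝓡 k)) (𝓡 d) (coordMap e i) q :=
  ((contMDiffOn_coordMap he i).contMDiffAt ((isOpen_coordDomain e i).mem_nhds hq)).mdifferentiableAt
    (by simp)

theorem tangentMap_proj_coordMap (he : IsSmoothTrivialization d n k e) (i : F) {y : Y} {u : E k}
    (hq : (y, u) ∈ coordDomain e i) (η : TangentSpace (𝓡 n) y) (t : E k) :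
    tangentMap (𝓡 d) (𝓡 n) p ⟨coordMap e i (y, u),
      mfderiv ((𝓡 n).prod (𝓡 k)) (𝓡 d) (coordMap e i) (y, u) ((η, t) : E n × E k)⟩ = ⟨y, η⟩ := by
  let v : TangentBundle ((𝓡 n).prod (𝓡 k)) (Y × E k) := ⟨(y, u), ((η, t) : E n × E k)⟩
  have hp := mdifferentiableAt_proj he (coordMap_mem_source e i hq.1)
  have hΘ := mdifferentiableAt_coordMap he i hq
  have h1 := tangentMap_comp_at v hp hΘ
  have hU : UniqueMDiffWithinAt ((𝓡 n).prod (𝓡 k)) (coordDomain e i) v.proj :=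
    (isOpen_coordDomain e i).uniqueMDiffWithinAt hq
  have h2 := tangentMapWithin_congr (I := (𝓡 n).prod (𝓡 k)) (I' := 𝓡 n) (f := p ∘ coordMap e i)
    (f₁ := Prod.fst) (s := coordDomain e i) (fun q hq => proj_coordMap e i hq.1) v hq
  rw [tangentMapWithin_eq_tangentMap hU (hp.comp v.proj hΘ),
    tangentMapWithin_eq_tangentMap hU mdifferentiableAt_fst, tangentMap_prodFst] at h2
  exact h1.symm.trans h2

theorem exists_vertical (he : IsSmoothTrivialization d n k e) (i : F) {q : Y × E k}
    (hq : q ∈ coordDomain e i) (ζ : TangentSpace (𝓡 d) (coordMap e i q))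
    (hζ : mfderiv (𝓡 d) (𝓡 n) p (coordMap e i q) ζ = 0) :
    ∃ t : E k, ζ = mfderiv ((𝓡 n).prod (𝓡 k)) (𝓡 d) (coordMap e i) q
      (((0 : E n), t) : E n × E k) := by
  revert ζ
  set x := coordMap e i q with hx
  intro ζ hζ
  have hxs : x ∈ e.source := coordMap_mem_source e i hq.1
  have hex : e x = (q.1, (chartAt (E k) i).symm q.2) := apply_coordMap e i hq.1
  have hsrc : (e x).2 ∈ (chartAt (E k) i).source := by
    rw [hex]
    exact (chartAt (E k) i).map_target hq.2
  let s : X → E k := fun x => chartAt (E k) i (e x).2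
  have hs : MDifferentiableAt (𝓡 d) (𝓡 k) s x :=
    (mdifferentiableAt_atlas (chart_mem_atlas _ _) hsrc).comp x
      (mdifferentiableAt_snd.comp x (mdifferentiableAt_trivialization he hxs))
  have hΞq : (p x, s x) = q := by
    refine Prod.ext (proj_coordMap e i hq.1) ?_
    change chartAt (E k) i (e x).2 = q.2
    rw [hex]
    exact (chartAt (E k) i).right_inv hq.2
  have hΞ : HasMFDerivAt (𝓡 d) ((𝓡 n).prod (𝓡 k)) (fun x => (p x, s x)) x _ :=
    (mdifferentiableAt_proj he hxs).hasMFDerivAt.prodMk hs.hasMFDerivAt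
  have hΘ : HasMFDerivAt ((𝓡 n).prod (𝓡 k)) (𝓡 d) (coordMap e i) (p x, s x) _ :=
    (mdifferentiableAt_coordMap he i (by rw [hΞq]; exact hq)).hasMFDerivAt
  have hcomp := hΘ.comp x hΞ
  have heq : (id : X → X) =ᶠ[𝓝 x] coordMap e i ∘ fun x => (p x, s x) := by
    have hopen : IsOpen (e.source ∩ e ⁻¹' (Set.univ ×ˢ (chartAt (E k) i).source)) :=
      e.toOpenPartialHomeomorph.isOpen_inter_preimage
        (isOpen_univ.prod (chartAt (E k) i).open_source)
    filter_upwards [hopen.mem_nhds ⟨hxs, Set.mem_univ _, hsrc⟩] with x' hx'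
    change x' = e.toOpenPartialHomeomorph.symm
      (p x', (chartAt (E k) i).symm (chartAt (E k) i (e x').2))
    rw [(chartAt (E k) i).left_inv hx'.2.2, ← e.proj_toFun x' hx'.1]
    exact (e.toOpenPartialHomeomorph.left_inv hx'.1).symm
  have hid := hasMFDerivAt_unique (hasMFDerivAt_id x) (hcomp.congr_of_eventuallyEq heq)
  have hmf : ∀ q', q' = q →
      (mfderiv ((𝓡 n).prod (𝓡 k)) (𝓡 d) (coordMap e i) q' : E n × E k →L[ℝ] E d) =
        mfderiv ((𝓡 n).prod (𝓡 k)) (𝓡 d) (coordMap e i) q := by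
    rintro _ rfl
    rfl
  refine ⟨mfderiv (𝓡 d) (𝓡 k) s x ζ, ?_⟩
  have h1 := DFunLike.congr_fun hid ζ
  refine h1.trans ((DFunLike.congr_fun (hmf (p x, s x) hΞq) _).trans ?_)
  refine congrArg (mfderiv ((𝓡 n).prod (𝓡 k)) (𝓡 d) (coordMap e i) q : E n × E k →L[ℝ] E d) ?_
  exact Prod.ext hζ rfl

theorem exists_tangentLift_sub (he : IsSmoothTrivialization d n k e) (i : F) {y : Y} {u : E k}
    (hq : (y, u) ∈ coordDomain e i) (η : TangentSpace (𝓡 n) y) :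
    ∃ t : E k, tangentLift d n p (coordMap e i (y, u)) ⟨y, η⟩ -
      mfderiv ((𝓡 n).prod (𝓡 k)) (𝓡 d) (coordMap e i) (y, u) ((η, (0 : E k)) : E n × E k) =
        mfderiv ((𝓡 n).prod (𝓡 k)) (𝓡 d) (coordMap e i) (y, u) (((0 : E n), t) : E n × E k) := by
  have h1 := tangentMap_proj_coordMap he i hq η 0
  have h2 : tangentMap (𝓡 d) (𝓡 n) p
      ⟨coordMap e i (y, u), tangentLift d n p (coordMap e i (y, u)) ⟨y, η⟩⟩ = ⟨y, η⟩ :=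
    Classical.epsilon_spec (p := fun ξ : TangentSpace (𝓡 d) (coordMap e i (y, u)) =>
      tangentMap (𝓡 d) (𝓡 n) p ⟨coordMap e i (y, u), ξ⟩ = ⟨y, η⟩) ⟨_, h1⟩
  refine exists_vertical he i hq _ ?_
  rw [map_sub, sub_eq_zero]
  exact TotalSpace.mk_inj.1 (h2.trans h1.symm)

theorem mfderiv_fiberInclusion (he : IsSmoothTrivialization d n k e) (i : F) {y : Y} {u : E k}
    (hq : (y, u) ∈ coordDomain e i) (t : E k) :
    mfderiv (𝓡 k) (𝓡 d) (fiberInclusion e y) ((chartAt (E k) i).symm u)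
      (mfderiv (𝓡 k) (𝓡 k) (chartAt (E k) i).symm u t) =
    mfderiv ((𝓡 n).prod (𝓡 k)) (𝓡 d) (coordMap e i) (y, u) (((0 : E n), t) : E n × E k) := by
  have h1 : HasMFDerivAt (𝓡 k) (𝓡 d) (fiberInclusion e y ∘ (chartAt (E k) i).symm) u _ :=
    (mdifferentiableAt_fiberInclusion he hq.1 _).hasMFDerivAt.comp u
      (mdifferentiableAt_atlas_symm (chart_mem_atlas _ _) hq.2).hasMFDerivAt
  have h2 : HasMFDerivAt (𝓡 k) (𝓡 d) (coordMap e i ∘ fun u => (y, u)) u _ :=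
    (mdifferentiableAt_coordMap he i hq).hasMFDerivAt.comp u
      ((hasMFDerivAt_const y u).prodMk (hasMFDerivAt_id u))
  exact DFunLike.congr_fun (hasMFDerivAt_unique h1 h2) t

theorem chartCoeff_paramDensity (he : IsSmoothTrivialization d n k e)
    {δ : TupleFunction d (j + k) X} (hδ : ∀ x, IsDecomposable (δ x)) (w : TangentTuple n j Y)
    (i : F) {u : E k} (hq : (w.base, u) ∈ coordDomain e i) :
    chartCoeff (paramDensity p δ w.base w.vec (fiberInclusion e w.base)) i u =
      δ (coordFrame e i w u).base (coordFrame e i w u).vec := by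
  have h1 : (fun a => mfderiv (𝓡 k) (𝓡 d) (fiberInclusion e w.base) ((chartAt (E k) i).symm u)
      (mfderiv (𝓡 k) (𝓡 k) (chartAt (E k) i).symm u (EuclideanSpace.single a (1 : ℝ) : E k))) =
      fun a => mfderiv ((𝓡 n).prod (𝓡 k)) (𝓡 d) (coordMap e i) (w.base, u)
        (((0 : E n), (EuclideanSpace.single a (1 : ℝ) : E k)) : E n × E k) :=
    funext fun a => mfderiv_fiberInclusion he i hq _
  refine Eq.trans (b := δ (coordMap e i (w.base, u)) (Fin.append
    (fun a => tangentLift d n p (coordMap e i (w.base, u)) ⟨w.base, w.vec a⟩)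
    fun a => mfderiv ((𝓡 n).prod (𝓡 k)) (𝓡 d) (coordMap e i) (w.base, u)
        (((0 : E n), (EuclideanSpace.single a (1 : ℝ) : E k)) : E n × E k))) ?_ ?_
  · rw [← h1]
    rfl
  · change _ = δ (coordMap e i (w.base, u)) (Fin.append
      (fun a => mfderiv ((𝓡 n).prod (𝓡 k)) (𝓡 d) (coordMap e i) (w.base, u)
        ((w.vec a, (0 : E k)) : E n × E k))
      fun a => mfderiv ((𝓡 n).prod (𝓡 k)) (𝓡 d) (coordMap e i) (w.base, u)
        (((0 : E n), (EuclideanSpace.single a (1 : ℝ) : E k)) : E n × E k))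
    refine (hδ (coordMap e i (w.base, u))).append_congr fun a => ?_
    obtain ⟨t, ht⟩ := exists_tangentLift_sub he i hq (w.vec a)
    rw [ht]
    have hrepr : (((0 : E n), t) : E n × E k) = ∑ b, t b •
        (((0 : E n), (EuclideanSpace.single b (1 : ℝ) : E k)) : E n × E k) := by
      refine Prod.ext ?_ ?_
      · simp [Prod.fst_sum]
      · simp only [Prod.snd_sum, Prod.smul_snd]
        ext c
        simp [Pi.single_apply]
    have h2 : mfderiv ((𝓡 n).prod (𝓡 k)) (𝓡 d) (coordMap e i) (w.base, u)
        (((0 : E n), t) : E n × E k) = ∑ b, t b •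
        mfderiv ((𝓡 n).prod (𝓡 k)) (𝓡 d) (coordMap e i) (w.base, u)
          (((0 : E n), (EuclideanSpace.single b (1 : ℝ) : E k)) : E n × E k) := by
      rw [hrepr]
      have := map_sum (mfderiv ((𝓡 n).prod (𝓡 k)) (𝓡 d) (coordMap e i) (w.base, u) :
        E n × E k →L[ℝ] E d) (fun b => t b •
        (((0 : E n), (EuclideanSpace.single b (1 : ℝ) : E k)) : E n × E k)) Finset.univ
      refine this.trans (Finset.sum_congr rfl fun b _ => ?_)
      exact (mfderiv ((𝓡 n).prod (𝓡 k)) (𝓡 d) (coordMap e i) (w.base, u) :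
        E n × E k →L[ℝ] E d).map_smul _ _
    rw [h2]
    exact Submodule.sum_mem _ fun b _ => Submodule.smul_mem _ _ (Submodule.subset_span ⟨b, rfl⟩)

/-- The integral over a fiber in the coordinates of a local trivialization. -/
theorem densityIntegral_paramDensity [T2Space F] [CompactSpace F] (he : IsSmoothTrivialization d n k e)
    {δ : TupleFunction d (j + k) X} (hdec : ∀ x, IsDecomposable (δ x)) (w : TangentTuple n j Y)
    (hw : w.base ∈ e.baseSet) :
    densityIntegral (paramDensity p δ w.base w.vec (fiberInclusion e w.base)) =
      ∑ i ∈ chartIndices k F, ∫ u in (chartAt (E k) i).target,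
        chartPartition k F i ((chartAt (E k) i).symm u) *
          δ (coordFrame e i w u).base (coordFrame e i w u).vec := by
  rw [densityIntegral_eq_sum]
  refine Finset.sum_congr rfl fun i _ =>
    setIntegral_congr_fun (chartAt (E k) i).open_target.measurableSet fun u hu =>
      congrArg _ (chartCoeff_paramDensity he hdec w i ⟨hw, hu⟩)

end Derivatives

end Coordinates

section Frames

variable {d n k j : ℕ} {X Y F : Type*}
  [TopologicalSpace X] [ChartedSpace (E d) X] [IsManifold (𝓡 d) ∞ X]
  [TopologicalSpace Y] [ChartedSpace (E n) Y] [IsManifold (𝓡 n) ∞ Y]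
  [TopologicalSpace F] [ChartedSpace (E k) F] [IsManifold (𝓡 k) ∞ F]
  {p : X → Y} {e : Trivialization F p}

theorem TangentTuple.isInducing {d m : ℕ} {X : Type*} [TopologicalSpace X] [ChartedSpace (E d) X]
    [IsManifold (𝓡 d) ∞ X] : Topology.IsInducing fun w : TangentTuple d m X =>
      (w.base, fun i => (⟨w.base, w.vec i⟩ : TangentBundle (𝓡 d) X)) :=
  ⟨rfl⟩

theorem TangentTuple.continuous_base :
    Continuous (TangentTuple.base : TangentTuple n j Y → Y) :=
  continuous_fst.comp TangentTuple.isInducing.continuous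

theorem TangentTuple.continuous_vec (a : Fin j) :
    Continuous fun w : TangentTuple n j Y => (⟨w.base, w.vec a⟩ : TangentBundle (𝓡 n) Y) :=
  (continuous_apply a).comp (continuous_snd.comp TangentTuple.isInducing.continuous)

theorem continuousOn_tangentMap_coordMap (he : IsSmoothTrivialization d n k e) (i : F) :
    ContinuousOn (tangentMap ((𝓡 n).prod (𝓡 k)) (𝓡 d) (coordMap e i))
      (TotalSpace.proj ⁻¹' coordDomain (k := k) e i) := by
  refine ((contMDiffOn_coordMap he i).continuousOn_tangentMapWithin (by simp)
    (isOpen_coordDomain e i).uniqueMDiffOn).congr fun v hv => ?_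
  exact (tangentMapWithin_eq_tangentMap ((isOpen_coordDomain e i).uniqueMDiffWithinAt hv)
    (mdifferentiableAt_coordMap he i hv)).symm

theorem continuous_modelVector (t : E k) :
    Continuous fun u : E k => (⟨u, t⟩ : TangentBundle (𝓡 k) (E k)) :=
  (tangentBundleModelSpaceHomeomorph (𝓡 k)).symm.continuous.comp
    (continuous_id.prodMk continuous_const)

theorem continuousOn_coordMap_vector (he : IsSmoothTrivialization d n k e) (i : F)
    {A : Type*} [TopologicalSpace A] {y : A → Y} {η : (a : A) → TangentSpace (𝓡 n) (y a)}
    (hη : Continuous fun a => (⟨y a, η a⟩ : TangentBundle (𝓡 n) Y)) (t : E k) :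
    ContinuousOn (fun z : A × E k => (⟨coordMap e i (y z.1, z.2),
      mfderiv ((𝓡 n).prod (𝓡 k)) (𝓡 d) (coordMap e i) (y z.1, z.2)
        ((η z.1, t) : E n × E k)⟩ : TangentBundle (𝓡 d) X))
      {z | (y z.1, z.2) ∈ coordDomain e i} := by
  have h1 : Continuous fun z : A × E k =>
      (equivTangentBundleProd (𝓡 n) Y (𝓡 k) (E k)).symm (⟨y z.1, η z.1⟩, ⟨z.2, t⟩) :=
    (contMDiff_equivTangentBundleProd_symm (n := 0)).continuous.comp
      ((hη.comp continuous_fst).prodMk ((continuous_modelVector t).comp continuous_snd))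
  exact (continuousOn_tangentMap_coordMap he i).comp h1.continuousOn fun z hz => hz

theorem continuousOn_coordFrame (he : IsSmoothTrivialization d n k e) (i : F) :
    ContinuousOn (fun z : TangentTuple n j Y × E k => coordFrame (d := d) e i z.1 z.2)
      {z | (z.1.base, z.2) ∈ coordDomain e i} := by
  rw [TangentTuple.isInducing.continuousOn_iff]
  refine ContinuousOn.prodMk ?_ (continuousOn_pi.2 fun a => ?_)
  · refine (contMDiffOn_coordMap he i).continuousOn.comp
      (f := fun z : TangentTuple n j Y × E k => (z.1.base, z.2)) ?_ fun z hz => hz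
    exact ((TangentTuple.continuous_base.comp continuous_fst).prodMk continuous_snd).continuousOn
  · refine Fin.addCases (fun a => ?_) (fun b => ?_) a
    · refine (continuousOn_coordMap_vector he i (TangentTuple.continuous_vec a) 0).congr
        fun z _ => ?_
      simp [coordFrame]
    · refine (continuousOn_coordMap_vector he i (y := TangentTuple.base (X := Y) (m := j))
        (η := fun _ => (0 : E n)) ?_ (EuclideanSpace.single b 1)).congr fun z _ => ?_
      · exact (contMDiff_zeroSection ℝ (TangentSpace (𝓡 n) : Y → Type _) (n := 0)
          (IB := 𝓡 n) (F := E n)).continuous.comp TangentTuple.continuous_base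
      · simp [coordFrame]

theorem continuousOn_chartCoeff (he : IsSmoothTrivialization d n k e)
    {δ : TupleFunction d (j + k) X} (hδ : IsDensity δ) (i : F) :
    ContinuousOn (fun z : TangentTuple n j Y × E k =>
      δ (coordFrame e i z.1 z.2).base (coordFrame e i z.1 z.2).vec)
      {z | (z.1.base, z.2) ∈ coordDomain e i} :=
  hδ.continuous.comp_continuousOn (continuousOn_coordFrame he i)

theorem continuousOn_chartCoeff_paramDensity (he : IsSmoothTrivialization d n k e)
    {δ : TupleFunction d (j + k) X} (hδ : IsDensity δ) (hdec : ∀ x, IsDecomposable (δ x))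
    {y : Y} (hy : y ∈ e.baseSet) (η : Fin j → TangentSpace (𝓡 n) y) (i : F) :
    ContinuousOn (chartCoeff (paramDensity p δ y η (fiberInclusion e y)) i)
      (chartAt (E k) i).target := by
  have h := (continuousOn_chartCoeff he hδ i).comp
    (f := fun u : E k => ((⟨y, η⟩ : TangentTuple n j Y), u)) (s := (chartAt (E k) i).target)
    (continuous_const.prodMk continuous_id).continuousOn fun u hu => ⟨hy, hu⟩
  exact h.congr fun u hu => chartCoeff_paramDensity he hdec ⟨y, η⟩ i ⟨hy, hu⟩

/-- The integral over a fiber does not depend on the local trivialization. -/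
theorem densityIntegral_fiberInclusion_eq [T2Space F] [CompactSpace F] {e' : Trivialization F p}
    (he : IsSmoothTrivialization d n k e) (he' : IsSmoothTrivialization d n k e')
    {δ : TupleFunction d (j + k) X} (hδ : IsDensity δ) (hdec : ∀ x, IsDecomposable (δ x))
    {y : Y} (hy : y ∈ e.baseSet) (hy' : y ∈ e'.baseSet) (η : Fin j → TangentSpace (𝓡 n) y) :
    densityIntegral (paramDensity p δ y η (fiberInclusion e y)) =
      densityIntegral (paramDensity p δ y η (fiberInclusion e' y)) := by
  have hsrc : ∀ {e e' : Trivialization F p}, y ∈ e.baseSet → y ∈ e'.baseSet → ∀ z,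
      fiberInclusion e y z ∈ e'.source := fun {e e'} hy hy' z =>
    e'.mem_source.2 (by rwa [fiberInclusion, e.proj_symm_apply' hy])
  have hinv : ∀ {e e' : Trivialization F p}, y ∈ e.baseSet → y ∈ e'.baseSet → ∀ z,
      fiberInclusion e' y (e' (fiberInclusion e y z)).2 = fiberInclusion e y z := by
    intro e e' hy hy' z
    have h1 : (e' (fiberInclusion e y z)).1 = y :=
      (e'.proj_toFun _ (hsrc hy hy' z)).trans (e.proj_symm_apply' hy)
    have h2 : (y, (e' (fiberInclusion e y z)).2) = e' (fiberInclusion e y z) := Prod.ext h1.symm rfl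
    rw [fiberInclusion, h2]
    exact e'.toOpenPartialHomeomorph.left_inv (hsrc hy hy' z)
  have hcancel : ∀ {e e' : Trivialization F p}, y ∈ e.baseSet → y ∈ e'.baseSet → ∀ z,
      (e (fiberInclusion e' y (e' (fiberInclusion e y z)).2)).2 = z := by
    intro e e' hy hy' z
    rw [hinv hy hy', fiberInclusion, e.apply_symm_apply' hy]
  have hsmooth : ∀ {e e' : Trivialization F p}, IsSmoothTrivialization d n k e →
      IsSmoothTrivialization d n k e' → y ∈ e.baseSet → y ∈ e'.baseSet →
      MDifferentiable (𝓡 k) (𝓡 k) fun z => (e' (fiberInclusion e y z)).2 :=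
    fun {e e'} he he' hy hy' z => mdifferentiableAt_snd.comp z
      ((mdifferentiableAt_trivialization he' (hsrc hy hy' z)).comp z
        (mdifferentiableAt_fiberInclusion he hy z))
  refine densityIntegral_pullback (g := fun z => (e' (fiberInclusion e y z)).2)
    (g' := fun z => (e (fiberInclusion e' y z)).2) (hsmooth he he' hy hy')
    (hsmooth he' he hy' hy).continuous (hcancel hy hy') (hcancel hy' hy) ?_ ?_
    (continuousOn_chartCoeff_paramDensity he' hδ hdec hy' η)
    (continuousOn_chartCoeff_paramDensity he hδ hdec hy η)
  · intro z f
    refine δ.congr_point (hinv hy hy' z).symm ?_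
    refine congrArg₂ Fin.append (funext fun i => ?_) (funext fun a => ?_)
    · exact congrArg (fun x => (tangentLift d n p x ⟨y, η i⟩ : E d)) (hinv hy hy' z).symm
    · have h1 : HasMFDerivAt (𝓡 k) (𝓡 d)
          (fiberInclusion e' y ∘ fun z => (e' (fiberInclusion e y z)).2) z _ :=
        (mdifferentiableAt_fiberInclusion he' hy' _).hasMFDerivAt.comp z
          (hsmooth he he' hy hy' z).hasMFDerivAt
      have h2 := h1.congr_of_eventuallyEq
        (Filter.Eventually.of_forall fun z => (hinv hy hy' z).symm)
      exact DFunLike.congr_fun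
        (hasMFDerivAt_unique (mdifferentiableAt_fiberInclusion he hy z).hasMFDerivAt h2) (f a)
  · intro z T L
    have h := (hdec (fiberInclusion e' y z)).append_comp
      (fun i => tangentLift d n p (fiberInclusion e' y z) ⟨y, η i⟩)
      ((mfderiv (𝓡 k) (𝓡 d) (fiberInclusion e' y) z).toLinearMap ∘ₗ T)
      (EuclideanSpace.basisFun (Fin k) ℝ).toBasis L
    simp only [OrthonormalBasis.coe_toBasis, EuclideanSpace.basisFun_apply] at h
    exact h

end Frames

section Pushforward

theorem detForm_pi_apply {d m : ℕ} {X : Type*} [TopologicalSpace X]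
    [ChartedSpace (E d) X] (φ : Fin m → (x : X) → TangentSpace (𝓡 d) x →ₗ[ℝ] ℝ) (x : X)
    (ξ : Fin m → TangentSpace (𝓡 d) x) :
    detForm (LinearMap.pi fun i => φ i x) ξ = (Matrix.of fun i a => φ i x (ξ a)).det := by
  rw [detForm_apply]
  rfl

variable {d n k j : ℕ} {X Y F : Type*}
  [TopologicalSpace X] [ChartedSpace (E d) X] [IsManifold (𝓡 d) ∞ X]
  [TopologicalSpace Y] [ChartedSpace (E n) Y] [IsManifold (𝓡 n) ∞ Y]
  [TopologicalSpace F] [ChartedSpace (E k) F] [IsManifold (𝓡 k) ∞ F]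
  {p : X → Y} {e : Trivialization F p}

theorem IsLocallyDecomposable.isDecomposable {m : ℕ} {δ : TupleFunction d m X}
    (h : IsLocallyDecomposable δ) (x : X) : IsDecomposable (δ x) := by
  obtain ⟨U, -, hx, c, φ, -, -, hδ⟩ := h x
  exact ⟨c x, LinearMap.pi fun i => φ i x, fun ξ => by rw [hδ x hx, detForm_pi_apply]⟩

/-- Locally in the fiber, the integral of `ξ ⌟ δ` is an average of absolute values of decomposable
forms. -/
theorem isCrofton_setIntegral_of_local (he : IsSmoothTrivialization d n k e)
    {δ : TupleFunction d (j + k) X} {y : Y} (hy : y ∈ e.baseSet) (i : F) {ρ : E k → ℝ}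
    {N : Set (E k)} (hN : IsCompact N) (hNT : N ⊆ (chartAt (E k) i).target)
    (hρ : ContinuousOn ρ N) {c : X → ℝ}
    {φ : Fin (j + k) → (x : X) → TangentSpace (𝓡 d) x →ₗ[ℝ] ℝ} {U : Set X}
    (hc : ContinuousOn c U) (hφ : ∀ i, IsOneFormOn (φ i) U)
    (hδ : ∀ x ∈ U, ∀ ξ : Fin (j + k) → TangentSpace (𝓡 d) x,
      δ x ξ = |c x * (Matrix.of fun i a => φ i x (ξ a)).det|)
    (hNU : ∀ u ∈ N, coordMap e i (y, u) ∈ U) (hρ0 : ∀ u ∈ N, 0 ≤ ρ u)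
    {S : Set (E k)} (hS : MeasurableSet S) (hSN : S ⊆ N) :
    IsCrofton (V := E n) fun η : Fin j → E n => ∫ u in S, ρ u *
      δ (coordFrame e i (⟨y, η⟩ : TangentTuple n j Y) u).base
        (coordFrame e i (⟨y, η⟩ : TangentTuple n j Y) u).vec := by
  obtain ⟨G, w, hGm, hwm, ⟨C, hC⟩, hR, -, hdet⟩ := exists_reduction j k
  let A : (x : X) → TangentSpace (𝓡 d) x →ₗ[ℝ] (Fin (j + k) → ℝ) := fun x =>
    LinearMap.pi fun l => φ l x
  let D : (u : E k) → E n × E k →ₗ[ℝ] (Fin (j + k) → ℝ) := fun u =>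
    A (coordMap e i (y, u)) ∘ₗ
      (mfderiv ((𝓡 n).prod (𝓡 k)) (𝓡 d) (coordMap e i) (y, u)).toLinearMap
  have hD : ∀ v l, ContinuousOn (fun u => D u v l) N := by
    intro v l
    have h1 := (continuousOn_coordMap_vector he i (A := Unit) (y := fun _ => y)
      (η := fun _ => v.1) continuous_const v.2).comp (f := fun u : E k => ((), u)) (s := N)
      (by fun_prop) fun u hu => ⟨hy, hNT hu⟩
    exact (hφ l).comp h1 hNU
  let B : E k → Fin k → Fin (j + k) → ℝ := fun u a => D u (0, EuclideanSpace.single a 1)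
  have hB : ContinuousOn B N :=
    continuousOn_pi.2 fun a => continuousOn_pi.2 fun l => hD _ l
  let ψ : E k → E n →L[ℝ] (Fin j → ℝ) := fun u => LinearMap.toContinuousLinearMap
    ((G (B u)).mulVecLin ∘ₗ D u ∘ₗ LinearMap.inl ℝ (E n) (E k))
  have hcρ : ContinuousOn (fun u => ρ u * c (coordMap e i (y, u))) N := by
    refine hρ.mul (hc.comp ?_ hNU)
    exact (contMDiffOn_coordMap he i).continuousOn.comp (f := fun u : E k => (y, u))
      (by fun_prop) fun u hu => ⟨hy, hNT hu⟩
  have hfin : IsFiniteMeasure (volume.restrict S) :=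
    ⟨by rw [Measure.restrict_apply_univ]; exact (measure_mono hSN).trans_lt hN.measure_lt_top⟩
  have hBm : AEMeasurable B (volume.restrict S) := (hB.mono hSN).aemeasurable hS
  obtain ⟨R₁, hR₁⟩ := hN.exists_bound_of_continuousOn hB
  obtain ⟨R₂, hR₂⟩ := hN.exists_bound_of_continuousOn hcρ
  obtain ⟨R₃, hR₃⟩ := hR R₁
  let b := (EuclideanSpace.basisFun (Fin n) ℝ).toBasis
  have hM : ContinuousOn (fun u a l => D u (b a, 0) l) N :=
    continuousOn_pi.2 fun a => continuousOn_pi.2 fun l => hD _ l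
  obtain ⟨R₄, hR₄⟩ := hN.exists_bound_of_continuousOn hM
  have hψ : ∀ u a l, ψ u (b a) l = ∑ r, G (B u) l r * D u (b a, 0) r := fun u a l => rfl
  have hcr := isCrofton_integral (volume.restrict S) b
    (w := fun u => ρ u * c (coordMap e i (y, u)) * w (B u)) (D := R₂ * R₃) (ψ := ψ)
    (C := (j + k : ℕ) * (C * R₄)) ?_ ?_ ?_ ?_
  · convert hcr using 2 with η
    refine setIntegral_congr_fun hS fun u hu => ?_
    have hx := hNU u (hSN hu)
    have h1 := hdet (fun a => D u (η a, 0)) (B u)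
    have h2 : detForm (A (coordMap e i (y, u)))
        (coordFrame e i (⟨y, η⟩ : TangentTuple n j Y) u).vec = (Matrix.of fun l a =>
          (Fin.append (fun a => D u (η a, 0)) (B u) : Fin (j + k) → Fin (j + k) → ℝ) a l).det := by
      refine (detForm_apply _ _).trans (congrArg Matrix.det (Matrix.ext fun l a => ?_))
      refine Fin.addCases (fun a => ?_) (fun a => ?_) a
      · simp only [coordFrame, Matrix.of_apply, Fin.append_left]
        rfl
      · simp only [coordFrame, Matrix.of_apply, Fin.append_right]
        rfl
    have h3 := (hδ _ hx (coordFrame e i (⟨y, η⟩ : TangentTuple n j Y) u).vec).trans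
      (congrArg (fun r => |c (coordMap e i (y, u)) * r|) ((detForm_pi_apply φ _ _).symm.trans h2))
    have h4 : |detForm (ψ u).toLinearMap η| =
        |(Matrix.of fun i a => (G (B u)).mulVec (D u (η a, 0)) i).det| := by
      rw [detForm_apply]
      rfl
    refine (congrArg (fun r => ρ u * r) h3).trans ?_
    change ρ u * |c (coordMap e i (y, u)) * _| = |_| * |detForm (ψ u).toLinearMap η|
    rw [h4, abs_mul, h1, abs_mul, abs_mul, abs_of_nonneg (hρ0 u (hSN hu))]
    ring
  · exact ((hcρ.mono hSN).aemeasurable hS).mul (hwm.comp_aemeasurable hBm)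
  · refine (ae_restrict_mem hS).mono fun u hu => ?_
    rw [abs_mul]
    refine mul_le_mul (hR₂ u (hSN hu)) (hR₃ _ fun a l => ?_) (abs_nonneg _)
      ((norm_nonneg _).trans (hR₂ u (hSN hu)))
    exact (norm_le_pi_norm (B u a) l).trans ((norm_le_pi_norm (B u) a).trans (hR₁ u (hSN hu)))
  · intro a l
    simp only [hψ]
    refine Finset.aemeasurable_fun_sum _ fun r _ => ?_
    exact ((hGm l r).comp_aemeasurable hBm).mul (((hD _ r).mono hSN).aemeasurable hS)
  · refine (ae_restrict_mem hS).mono fun u hu a l => ?_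
    rw [hψ]
    refine (Finset.abs_sum_le_sum_abs _ _).trans ?_
    refine (Finset.sum_le_card_nsmul _ _ (C * R₄) fun r _ => ?_).trans (by simp)
    rw [abs_mul]
    refine mul_le_mul (hC _ _ _) ?_ (abs_nonneg _) ((abs_nonneg _).trans (hC (B u) l r))
    have h := hR₄ u (hSN hu)
    exact (norm_le_pi_norm (fun l => D u (b a, 0) l) r).trans
      ((norm_le_pi_norm (fun a l => D u (b a, 0) l) a).trans h)

variable [T2Space F] [CompactSpace F]

theorem isCrofton_chartIntegral (he : IsSmoothTrivialization d n k e)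
    {δ : TupleFunction d (j + k) X} (hδ : IsDensity δ) (hdec : IsLocallyDecomposable δ)
    {y : Y} (hy : y ∈ e.baseSet) (i : F) :
    IsCrofton (V := E n) fun η : Fin j → E n => ∫ u in (chartAt (E k) i).target,
      chartPartition k F i ((chartAt (E k) i).symm u) *
        δ (coordFrame e i (⟨y, η⟩ : TangentTuple n j Y) u).base
          (coordFrame e i (⟨y, η⟩ : TangentTuple n j Y) u).vec := by
  set T := (chartAt (E k) i).target with hT
  let f : (Fin j → E n) → E k → ℝ := fun η u =>
    chartPartition k F i ((chartAt (E k) i).symm u) *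
      δ (coordFrame e i (⟨y, η⟩ : TangentTuple n j Y) u).base
        (coordFrame e i (⟨y, η⟩ : TangentTuple n j Y) u).vec
  have hint : ∀ η, IntegrableOn (f η) T := fun η => integrableOn_chartPartition_mul
    ((continuousOn_chartCoeff he hδ i).comp
      (f := fun u : E k => ((⟨y, η⟩ : TangentTuple n j Y), u))
      (continuous_const.prodMk continuous_id).continuousOn fun u hu => ⟨hy, hu⟩)
  have hloc : ∃ t, chartSupport i ⊆ t ∧ t ⊆ T ∧ MeasurableSet t ∧ ∀ S ⊆ t, MeasurableSet S →
      IsCrofton (V := E n) fun η => ∫ u in S, f η u := by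
    refine (isCompact_chartSupport i).induction_on (p := fun s => ∃ t, s ⊆ t ∧ t ⊆ T ∧
      MeasurableSet t ∧ ∀ S ⊆ t, MeasurableSet S →
      IsCrofton (V := E n) fun η => ∫ u in S, f η u) ?_ ?_ ?_ ?_
    · refine ⟨∅, le_rfl, Set.empty_subset _, MeasurableSet.empty, fun S hS _ => ?_⟩
      rw [Set.subset_empty_iff.1 hS]
      simpa using isCrofton_zero
    · rintro s s' hs ⟨t, h⟩
      exact ⟨t, hs.trans h.1, h.2⟩
    · rintro s s' ⟨t, hs, htT, htm, ht⟩ ⟨t', hs', htT', htm', ht'⟩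
      refine ⟨t ∪ t', Set.union_subset_union hs hs', Set.union_subset htT htT', htm.union htm',
        fun S hS hSm => ?_⟩
      have h := (ht (S ∩ t) Set.inter_subset_right (hSm.inter htm)).add
        (ht' (S \ t) (fun u hu => (hS hu.1).resolve_left hu.2) (hSm.diff htm))
      convert h using 2 with η
      exact (integral_inter_add_sdiff htm
        ((hint η).mono_set (hS.trans (Set.union_subset htT htT')))).symm
    · intro u₀ hu₀
      have huT := chartSupport_subset i hu₀
      obtain ⟨U, hU, hxU, c, φ, hc, hφ, hδU⟩ := hdec (coordMap e i (y, u₀))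
      have hcont : ContinuousOn (fun u : E k => coordMap e i (y, u)) T :=
        (contMDiffOn_coordMap he i).continuousOn.comp (f := fun u : E k => (y, u))
          (by fun_prop) fun u hu => ⟨hy, hu⟩
      have hopen : IsOpen (T ∩ (fun u : E k => coordMap e i (y, u)) ⁻¹' U) :=
        hcont.isOpen_inter_preimage (chartAt (E k) i).open_target hU
      obtain ⟨N, hN, huN, hNsub⟩ := exists_compact_subset hopen ⟨huT, hxU⟩
      refine ⟨N, mem_nhdsWithin_of_mem_nhds (mem_interior_iff_mem_nhds.1 huN), N, le_rfl,
        fun u hu => (hNsub hu).1, hN.measurableSet, fun S hSN hS => ?_⟩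
      exact isCrofton_setIntegral_of_local he hy i hN (fun u hu => (hNsub hu).1)
        ((continuousOn_chartPartition i).mono fun u hu => (hNsub hu).1) hc hφ hδU
        (fun u hu => (hNsub hu).2) (fun u _ => (chartPartition k F).nonneg i _) hS hSN
  obtain ⟨t, hKt, htT, htm, ht⟩ := hloc
  convert ht t le_rfl htm using 2 with η
  refine setIntegral_eq_of_subset_of_forall_sdiff_eq_zero
    (chartAt (E k) i).open_target.measurableSet htT fun u hu => ?_
  rw [chartPartition_eq_zero_of_notMem hu.1 fun h => hu.2 (hKt h), zero_mul]

theorem continuousOn_chartIntegral (he : IsSmoothTrivialization d n k e)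
    {δ : TupleFunction d (j + k) X} (hδ : IsDensity δ) (i : F) :
    ContinuousOn (fun w : TangentTuple n j Y => ∫ u in (chartAt (E k) i).target,
        chartPartition k F i ((chartAt (E k) i).symm u) *
          δ (coordFrame e i w u).base (coordFrame e i w u).vec) {w | w.base ∈ e.baseSet} := by
  set T := (chartAt (E k) i).target with hT
  have hTo : IsOpen T := (chartAt (E k) i).open_target
  let f : TangentTuple n j Y → E k → ℝ := fun w => T.indicator fun u =>
    chartPartition k F i ((chartAt (E k) i).symm u) *
      δ (coordFrame e i w u).base (coordFrame e i w u).vec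
  have hf0 : ∀ w u, u ∉ chartSupport i → f w u = 0 := by
    intro w u hu
    by_cases huT : u ∈ T
    · simp only [f, Set.indicator_of_mem huT]
      rw [chartPartition_eq_zero_of_notMem huT hu, zero_mul]
    · exact Set.indicator_of_notMem huT _
  have hfc : ContinuousOn f.uncurry ({w | w.base ∈ e.baseSet} ×ˢ Set.univ) := by
    rintro ⟨w, u⟩ ⟨hw, -⟩
    refine ContinuousAt.continuousWithinAt ?_
    by_cases hu : u ∈ T
    · have hopen : IsOpen {z : TangentTuple n j Y × E k | (z.1.base, z.2) ∈ coordDomain e i} :=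
        (isOpen_coordDomain e i).preimage
          ((TangentTuple.continuous_base.comp continuous_fst).prodMk continuous_snd)
      have hnhds := hopen.mem_nhds (show (w, u) ∈ _ from ⟨hw, hu⟩)
      have h1 : ContinuousOn (fun z : TangentTuple n j Y × E k =>
          chartPartition k F i ((chartAt (E k) i).symm z.2) *
            δ (coordFrame e i z.1 z.2).base (coordFrame e i z.1 z.2).vec)
          {z | (z.1.base, z.2) ∈ coordDomain e i} :=
        ((continuousOn_chartPartition i).comp continuousOn_snd fun z hz => hz.2).mul
          (continuousOn_chartCoeff he hδ i)
      refine (h1.continuousAt hnhds).congr ?_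
      filter_upwards [hnhds] with z hz
      have h2 : f z.1 z.2 = _ := Set.indicator_of_mem (show z.2 ∈ T from hz.2) _
      exact h2.symm
    · have hK : IsOpen {z : TangentTuple n j Y × E k | z.2 ∉ chartSupport i} :=
        (isCompact_chartSupport i).isClosed.isOpen_compl.preimage continuous_snd
      refine (continuousAt_const : ContinuousAt (fun _ => (0 : ℝ)) (w, u)).congr ?_
      filter_upwards [hK.mem_nhds (show (w, u) ∈ _ from fun h => hu (chartSupport_subset i h))]
        with z hz
      exact (hf0 z.1 z.2 hz).symm
  have h := continuousOn_integral_of_compact_support (μ := volume) (isCompact_chartSupport i) hfc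
    fun w u _ hu => hf0 w u hu
  refine h.congr fun w _ => ?_
  exact (integral_indicator hTo.measurableSet).symm

/-- The push-forward of a locally decomposable density along a bundle with compact fibers is
normal. -/
theorem isNormalDensity_pushforward (hp : IsSmoothFiberBundle d n k F p)
    {δ : TupleFunction d (j + k) X} (hδ : IsDensity δ) (hdec : IsLocallyDecomposable δ) :
    IsNormalDensity (pushforward hp δ) := by
  have hdec' : ∀ x, IsDecomposable (δ x) := hdec.isDecomposable
  have he : ∀ y, IsSmoothTrivialization d n k (hp y).choose := fun y =>
    ⟨(hp y).choose_spec.2.1, (hp y).choose_spec.2.2⟩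
  have hmem : ∀ y, y ∈ (hp y).choose.baseSet := fun y => (hp y).choose_spec.1
  have hpush : ∀ w : TangentTuple n j Y, pushforward hp δ w.base w.vec = densityIntegral
      (paramDensity p δ w.base w.vec (fiberInclusion (hp w.base).choose w.base)) := fun w => rfl
  have hcrofton : ∀ y, IsCrofton (V := E n) (pushforward hp δ y : (Fin j → E n) → ℝ) := by
    intro y
    have h := isCrofton_sum (chartIndices k F) fun i _ =>
      isCrofton_chartIntegral (he y) hδ hdec (hmem y) i
    refine Eq.mpr (congrArg (IsCrofton (V := E n)) (funext fun η => ?_)) h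
    exact (hpush ⟨y, η⟩).trans (densityIntegral_paramDensity (he y) hdec' ⟨y, η⟩ (hmem y))
  refine ⟨⟨fun y => (hcrofton y).isHomogeneousDensity, ?_⟩, fun y => (hcrofton y).isNormal⟩
  refine continuous_iff_continuousAt.2 fun w₀ => ?_
  have hopen : IsOpen {w : TangentTuple n j Y | w.base ∈ (hp w₀.base).choose.baseSet} :=
    (hp w₀.base).choose.open_baseSet.preimage TangentTuple.continuous_base
  have hnhds := hopen.mem_nhds (hmem w₀.base)
  have hcont := continuousOn_finsetSum (chartIndices k F) fun i _ =>
    continuousOn_chartIntegral (j := j) (he w₀.base) hδ i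
  refine (hcont.continuousAt hnhds).congr ?_
  filter_upwards [hnhds] with w hw
  rw [hpush, densityIntegral_fiberInclusion_eq (he w.base) (he w₀.base) hδ hdec' (hmem w.base) hw,
    densityIntegral_paramDensity (he w₀.base) hdec' w hw]

end Pushforward

end NormalDensity

theorem proposition3p1 {d n k j : ℕ} {X Y F : Type*}
    [TopologicalSpace X] [ChartedSpace (NormalDensity.E d) X] [IsManifold (𝓡 d) ∞ X]
    [T2Space X] [SecondCountableTopology X]
    [TopologicalSpace Y] [ChartedSpace (NormalDensity.E n) Y] [IsManifold (𝓡 n) ∞ Y]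
    [T2Space Y] [SecondCountableTopology Y]
    [TopologicalSpace F] [ChartedSpace (NormalDensity.E k) F] [IsManifold (𝓡 k) ∞ F]
    [T2Space F] [CompactSpace F]
    (p : X → Y) (hp : NormalDensity.IsSmoothFiberBundle d n k F p)
    (δ : NormalDensity.TupleFunction d (j + k) X) (hδ : NormalDensity.IsDensity δ)
    (hdec : NormalDensity.IsLocallyDecomposable δ) :
    NormalDensity.IsNormalDensity (NormalDensity.pushforward hp δ) := by
  exact NormalDensity.isNormalDensity_pushforward hp hδ hdec
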